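/- Let $N\ge 1$ and $p=p_F:=1+\frac2N$. For $0<\alpha<1$ let $h_\alpha$ be the probability density on $(0,\infty)$ (the M-Wright function) that is continuous and positive and satisfies $\int_0^\infty h_\alpha(\theta)e^{z\theta}\,d\theta=E_{\alpha,1}(z):=\sum_{k\ge0}\frac{z^k}{\Gamma(\alpha k+1)}$ for all $z\in\mathbb C$. For a nonnegative Borel measure $\mu$ on $\mathbb R^N$ put $e^{t\Delta}\mu(x)=\int_{\mathbb R^N}(4\pi t)^{-N/2}e^{-|x-y|^2/(4t)}\,d\mu(y)$ and $$P_\alpha(t)\mu=\int_0^\infty h_\alpha(\theta)\,e^{t^\alpha\theta\Delta}\mu\,d\theta,\qquad S_\alpha(t)\mu=\int_0^\infty\theta h_\alpha(\theta)\,e^{t^\alpha\theta\Delta}\mu\,d\theta ,$$ where a nonnegative function $f$ is identified with the measure $f\,dx$. For a nonnegative finite measure $\mu$ on $\mathbb R^N$ and $0<T<\infty$, a nonnegative measurable function $u$ on $(0,T]\times\mathbb R^N$ is a solution on $[0,T]\times\mathbb R^N$ of $$\partial_t^\alpha u-\Delta u=u^p,\qquad u(0)=\mu \qquad (\partial_t^\alpha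 \text{ the Caputo derivative})$$ if $$\infty>u(t,x)=[P_\alpha(t)\mu](x)+\alpha\int_0^t(t-s)^{\alpha-1}[S_\alpha(t-s)u(s)^p](x)\,ds$$ for almost all $t\in(0,T]$ and $x\in\mathbb R^N$. A global-in-time solution is a function on $(0,\infty)\times\mathbb R^N$ that is a solution on $[0,T]\times\mathbb R^N$ for every $T>0$. Let $\mathcal G_\alpha$ be the set of nonnegative finite measures $\nu$ on $\mathbb R^N$ such that the problem with $u(0)=\nu$ possesses a global-in-time solution, and for $r>0$ let $\mathcal B^+(r)$ be the set of nonnegative measures on $\mathbb R^N$ of total mass at most $r$. Theorem. There exist constants $0<C_1\le C_2$, depending only on $N$, and $\alpha_0\in(0,1)$ such that for all $\alpha\in(\alpha_0,1)$ $$\mathcal B^+\big(C_1(1-\alpha)^{N/2}\big)\subset\mathcal G_\alpha\subset\mathcal B^+\big(C_2(1-\alpha)^{N/2}\big).$$ In particular, for all $\alpha\in(\alpha_0,1)$ $$C_1(1-\alpha)^{N/2}\le\sup_{\nu\in\mathcal G_\alpha}\nu(\mathbb R^N)\le C_2(1-\alpha)^{N/2},$$ and $\displaystyle\lim_{\alpha\to1^-}\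 \sup_{\nu\in\mathcal G_\alpha}\nu(\mathbb R^N)=0$. -/

import Mathlib

open MeasureTheory Set Filter Topology
open scoped ENNReal

namespace TimeFracHeat

/-- The Mittag-Leffler function `E_{a,b}(z) = ∑ zᵏ / Γ(a k + b)`. -/
noncomputable def mittagLeffler (a b : ℝ) (z : ℂ) : ℂ :=
  ∑' k : ℕ, z ^ k / Complex.Gamma ((a : ℂ) * k + b)

/-- The angular kernel in the Mikusinski-Zolotarev integral representation of positive stable
densities. -/
noncomputable def zolotarevKernel (α φ : ℝ) : ℝ :=
  Real.sin ((1 - α) * φ) * Real.sin (α * φ) ^ (α / (1 - α)) / Real.sin φ ^ (1 / (1 - α))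

/-- The probability density `h_α` on `(0, ∞)` of the time-fractional subordination formula (the
M-Wright, or Mainardi, function), written through its integral representation, for `0 < α < 1`.
It is the density with `∫ h_α(θ) e^{zθ} dθ = E_{α,1}(z)` for all `z ∈ ℂ`: this, together with
`h_α > 0` and `∫ h_α = 1`, is proved below. -/
noncomputable def wrightDensity (α θ : ℝ) : ℝ :=
  θ ^ (α / (1 - α)) / (Real.pi * (1 - α)) *
    ∫ φ in Ioo 0 Real.pi, zolotarevKernel α φ * Real.exp (-zolotarevKernel α φ * θ ^ (1 / (1 - α)))

theorem sum_choose_sinc (n : ℕ) : ∀ x : ℝ,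
    ∑ k ∈ Finset.range (n + 1), (n.choose k : ℝ) * Real.sinc (((k : ℝ) - x) * Real.pi)
      = (Real.Gamma (n + 1)) * ((Real.Gamma (1 + x))⁻¹ * (Real.Gamma (1 + n - x))⁻¹) := by
  have hrec : ∀ s : ℝ, (Real.Gamma s)⁻¹ = s * (Real.Gamma (s + 1))⁻¹ := by
    intro s
    rcases eq_or_ne s 0 with rfl | hs
    · simp [Real.Gamma_zero]
    · rw [Real.Gamma_add_one hs, mul_inv, ← mul_assoc, mul_inv_cancel₀ hs, one_mul]
  induction n with
  | zero =>
    intro x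
    have hp := Real.pi_ne_zero
    rcases eq_or_ne x 0 with rfl | hx
    · simp
    · have h1 := Real.Gamma_mul_Gamma_one_sub x
      simp only [zero_add, Finset.range_one, Finset.sum_singleton, Nat.choose_self, Nat.cast_one,
        one_mul, Nat.cast_zero, Real.Gamma_one, add_zero, zero_sub, neg_mul, Real.sinc_neg]
      rw [Real.sinc_of_ne_zero (mul_ne_zero hx hp), add_comm 1 x, Real.Gamma_add_one hx,
        ← mul_inv, mul_assoc, h1, mul_comm Real.pi x, ← mul_div_assoc, inv_div]
  | succ n ih =>
    intro x
    have hx := ih x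
    have hx' := ih (x - 1)
    have e1 : ∑ k ∈ Finset.range (n + 1 + 1), ((n + 1).choose k : ℝ) *
          Real.sinc (((k : ℝ) - x) * Real.pi)
        = (∑ k ∈ Finset.range (n + 1), (n.choose k : ℝ) * Real.sinc (((k : ℝ) - x) * Real.pi))
        + ∑ k ∈ Finset.range (n + 1), (n.choose k : ℝ) *
          Real.sinc (((k : ℝ) - (x - 1)) * Real.pi) := by
      rw [Finset.sum_range_succ']
      simp only [Nat.choose_succ_succ, Nat.cast_add, add_mul, Finset.sum_add_distrib]
      rw [Finset.sum_range_succ (fun k : ℕ => ((n.choose (k + 1) : ℕ) : ℝ) * _),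
        Finset.sum_range_succ' (fun k : ℕ => ((n.choose k : ℕ) : ℝ) *
          Real.sinc (((k : ℝ) - x) * Real.pi))]
      simp [sub_sub_eq_add_sub, add_sub_right_comm]
      ring
    rw [e1, hx, hx']
    push_cast
    have h1 := hrec x
    have h2 := hrec (1 + n - x)
    have h3 : Real.Gamma ((n : ℝ) + 1 + 1) = (n + 1) * Real.Gamma (n + 1) :=
      Real.Gamma_add_one (by positivity)
    rw [h3, show (1 : ℝ) + (x - 1) = x by ring, show (1 : ℝ) + n - (x - 1) = 1 + n - x + 1 by ring,
      show (1 : ℝ) + (n + 1) - x = 1 + n - x + 1 by ring, h1, h2, add_comm x 1]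
    ring

/-- The angular integral that gives the integer moments of the Wright density. -/
theorem integral_kernel_pow {α : ℝ} (h0 : 0 < α) (h1 : α < 1) (n : ℕ) :
    IntervalIntegrable (fun φ : ℝ => (Real.sin φ ^ n /
        (Real.sin ((1 - α) * φ) ^ ((1 - α) * n) * Real.sin (α * φ) ^ (α * n)))) volume 0 Real.pi ∧
    ∫ φ in (0 : ℝ)..Real.pi, (Real.sin φ ^ n /
        (Real.sin ((1 - α) * φ) ^ ((1 - α) * n) * Real.sin (α * φ) ^ (α * n)))
      = Real.pi * (Real.Gamma (n + 1) *
        ((Real.Gamma (1 + α * n))⁻¹ * (Real.Gamma (1 + (1 - α) * n))⁻¹)) := by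
  have hpi := Real.pi_pos
  have hβ : 0 < 1 - α := by linarith
  set D : ℝ → ℝ := fun φ => (Real.sin φ ^ n /
        (Real.sin ((1 - α) * φ) ^ ((1 - α) * n) * Real.sin (α * φ) ^ (α * n))) with hD
  set r : ℝ → ℝ := fun φ => α * Real.sinc (α * φ) / ((1 - α) * Real.sinc ((1 - α) * φ)) with hr
  set F : ℝ → ℝ := fun φ => ∑ k ∈ Finset.range (n + 1), (n.choose k : ℝ) *
    (r φ ^ ((k : ℝ) - α * n) * (φ * Real.sinc (((k : ℝ) - α * n) * φ))) with hF
  have spos : ∀ c : ℝ, 0 < c → c < 1 → ∀ φ ∈ Icc 0 Real.pi, 0 < Real.sinc (c * φ) := by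
    intro c hc hc1 φ hφ
    rcases eq_or_lt_of_le hφ.1 with h | h
    · simp [← h]
    · rw [Real.sinc_of_ne_zero (by positivity)]
      refine div_pos (Real.sin_pos_of_pos_of_lt_pi (by positivity) ?_) (by positivity)
      nlinarith [hφ.2]
  have rpos : ∀ φ ∈ Icc 0 Real.pi, 0 < r φ := by
    intro φ hφ
    have := spos α h0 h1 φ hφ
    have := spos (1 - α) hβ (by linarith) φ hφ
    simp only [hr]; positivity
  have hFc : ContinuousOn F (Icc 0 Real.pi) := by
    have cr : ContinuousOn r (Icc 0 Real.pi) := by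
      refine ContinuousOn.div (Continuous.continuousOn ?_) (Continuous.continuousOn ?_) ?_
      · exact continuous_const.mul (Real.continuous_sinc.comp (by fun_prop))
      · exact continuous_const.mul (Real.continuous_sinc.comp (by fun_prop))
      · intro φ hφ
        exact (mul_pos hβ (spos (1 - α) hβ (by linarith) φ hφ)).ne'
    refine continuousOn_finsetSum _ fun k _ => ?_
    refine ContinuousOn.mul continuousOn_const (ContinuousOn.mul
      (cr.rpow_const fun φ hφ => Or.inl (rpos φ hφ).ne') (Continuous.continuousOn ?_))
    exact continuous_id.mul (Real.continuous_sinc.comp (by fun_prop))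
  have hDnn : ∀ φ ∈ Ioo 0 Real.pi, 0 ≤ D φ := by
    intro φ hφ
    have s1 : 0 < Real.sin φ := Real.sin_pos_of_pos_of_lt_pi hφ.1 hφ.2
    have s2 : 0 < Real.sin (α * φ) :=
      Real.sin_pos_of_pos_of_lt_pi (mul_pos h0 hφ.1) (by nlinarith [hφ.2, hφ.1])
    have s3 : 0 < Real.sin ((1 - α) * φ) :=
      Real.sin_pos_of_pos_of_lt_pi (mul_pos hβ hφ.1) (by nlinarith [hφ.2, hφ.1])
    simp only [hD]; positivity
  have hderiv : ∀ φ ∈ Ioo 0 Real.pi, HasDerivAt F (D φ) φ := by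
    intro φ hφ
    have s1 : 0 < Real.sin φ := Real.sin_pos_of_pos_of_lt_pi hφ.1 hφ.2
    have s2 : 0 < Real.sin (α * φ) :=
      Real.sin_pos_of_pos_of_lt_pi (mul_pos h0 hφ.1) (by nlinarith [hφ.2, hφ.1])
    have s3 : 0 < Real.sin ((1 - α) * φ) :=
      Real.sin_pos_of_pos_of_lt_pi (mul_pos hβ hφ.1) (by nlinarith [hφ.2, hφ.1])
    have req : ∀ ψ ∈ Ioo 0 Real.pi, r ψ = Real.sin (α * ψ) / Real.sin ((1 - α) * ψ) := by
      intro ψ hψ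
      have hne := hψ.1.ne'
      have hb' := hβ.ne'
      simp only [hr]
      rw [Real.sinc_of_ne_zero (mul_ne_zero h0.ne' hne),
        Real.sinc_of_ne_zero (mul_ne_zero hb' hne)]
      field_simp
    obtain ⟨ρ, hρ⟩ : ∃ ρ : ℝ, HasDerivAt r (ρ * r φ) φ := by
      have hdiff : DifferentiableAt ℝ (fun ψ => Real.sin (α * ψ) / Real.sin ((1 - α) * ψ)) φ :=
        DifferentiableAt.fun_div (by fun_prop) (by fun_prop) s3.ne'
      have heq : r =ᶠ[𝓝 φ] fun ψ => Real.sin (α * ψ) / Real.sin ((1 - α) * ψ) :=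
        Filter.eventuallyEq_of_mem (Ioo_mem_nhds hφ.1 hφ.2) req
      refine ⟨deriv r φ / r φ, ?_⟩
      rw [div_mul_cancel₀ _ (rpos φ ⟨hφ.1.le, hφ.2.le⟩).ne']
      exact (hdiff.congr_of_eventuallyEq heq).hasDerivAt
    have hrp := rpos φ ⟨hφ.1.le, hφ.2.le⟩
    have hs : ∀ c : ℝ, HasDerivAt (fun ψ => ψ * Real.sinc (c * ψ)) (Real.cos (c * φ)) φ := by
      intro c
      rcases eq_or_ne c 0 with rfl | hc
      · simp only [zero_mul, Real.sinc_zero, mul_one, Real.cos_zero]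
        exact hasDerivAt_id' φ
      · have : HasDerivAt (fun ψ => Real.sin (c * ψ) / c) (Real.cos (c * φ)) φ := by
          have h := (((hasDerivAt_id' φ).const_mul c).sin).div_const c
          rwa [mul_one, mul_div_cancel_right₀ _ hc] at h
        refine this.congr_of_eventuallyEq
          (Filter.eventuallyEq_of_mem (Ioi_mem_nhds hφ.1) fun ψ hψ => ?_)
        have : ψ ≠ 0 := (mem_Ioi.mp hψ).ne'
        show ψ * Real.sinc (c * ψ) = Real.sin (c * ψ) / c
        rw [Real.sinc_of_ne_zero (mul_ne_zero hc this)]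
        field_simp
    have hsv : ∀ c : ℝ, c * (φ * Real.sinc (c * φ)) = Real.sin (c * φ) := by
      intro c
      rcases eq_or_ne c 0 with rfl | hc
      · simp
      · have := hφ.1.ne'
        rw [Real.sinc_of_ne_zero (mul_ne_zero hc this)]
        field_simp
    have hd : HasDerivAt F (∑ k ∈ Finset.range (n + 1), (n.choose k : ℝ) *
        ((ρ * r φ) * ((k : ℝ) - α * n) * r φ ^ ((k : ℝ) - α * n - 1) *
            (φ * Real.sinc (((k : ℝ) - α * n) * φ))
          + r φ ^ ((k : ℝ) - α * n) * Real.cos (((k : ℝ) - α * n) * φ))) φ := by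
      refine HasDerivAt.fun_sum fun k _ => HasDerivAt.const_mul _ ?_
      exact (hρ.rpow_const (Or.inl hrp.ne')).mul (hs _)
    convert hd using 1
    set x := α * n with hx
    have hterm : ∀ k ∈ Finset.range (n + 1), (n.choose k : ℝ) *
        ((ρ * r φ) * ((k : ℝ) - x) * r φ ^ ((k : ℝ) - x - 1) *
            (φ * Real.sinc (((k : ℝ) - x) * φ))
          + r φ ^ ((k : ℝ) - x) * Real.cos (((k : ℝ) - x) * φ))
        = r φ ^ (-x) * (ρ * ((n.choose k : ℝ) * r φ ^ k * Real.sin (((k : ℝ) - x) * φ))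
          + (n.choose k : ℝ) * r φ ^ k * Real.cos (((k : ℝ) - x) * φ)) := by
      intro k _
      have e1 : r φ ^ ((k : ℝ) - x - 1) = r φ ^ (-x) * r φ ^ k / r φ := by
        rw [Real.rpow_sub_one hrp.ne', sub_eq_neg_add, Real.rpow_add hrp, Real.rpow_natCast]
      have e2 : r φ ^ ((k : ℝ) - x) = r φ ^ (-x) * r φ ^ k := by
        rw [sub_eq_neg_add, Real.rpow_add hrp, Real.rpow_natCast]
      rw [e1, e2, ← hsv]
      field_simp
    rw [Finset.sum_congr rfl hterm, ← Finset.mul_sum, Finset.sum_add_distrib, ← Finset.mul_sum]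
    have hc : ∑ k ∈ Finset.range (n + 1), ((n.choose k : ℝ) * r φ ^ k : ℝ) *
        Complex.exp ((((k : ℝ) - x) * φ : ℝ) * Complex.I)
        = (((Real.sin φ / Real.sin ((1 - α) * φ)) ^ n : ℝ) : ℂ) := by
      have h1e : (1 : ℂ) + (r φ : ℂ) * Complex.exp (φ * Complex.I)
          = ((Real.sin φ / Real.sin ((1 - α) * φ) : ℝ) : ℂ) *
            Complex.exp ((α * φ : ℝ) * Complex.I) := by
        have hsplit : φ = (1 - α) * φ + α * φ := by ring
        rw [req φ hφ, Complex.exp_mul_I, Complex.exp_mul_I, ← Complex.ofReal_cos,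
          ← Complex.ofReal_sin, ← Complex.ofReal_cos, ← Complex.ofReal_sin]
        have key1 : 1 + Real.sin (α * φ) / Real.sin ((1 - α) * φ) * Real.cos φ
            = Real.sin φ / Real.sin ((1 - α) * φ) * Real.cos (α * φ) := by
          have : Real.sin ((1 - α) * φ) = Real.sin φ * Real.cos (α * φ)
              - Real.cos φ * Real.sin (α * φ) := by
            rw [← Real.sin_sub]; congr 1; ring
          have hne := s3.ne'
          rw [div_mul_eq_mul_div, div_mul_eq_mul_div, eq_div_iff hne, add_mul,
            div_mul_cancel₀ _ hne, this]
          ring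
        have key2 : Real.sin (α * φ) / Real.sin ((1 - α) * φ) * Real.sin φ
            = Real.sin φ / Real.sin ((1 - α) * φ) * Real.sin (α * φ) := by ring
        apply Complex.ext
        · simpa [-Complex.ofReal_div, -Complex.ofReal_sin, -Complex.ofReal_cos] using key1
        · simpa [-Complex.ofReal_div, -Complex.ofReal_sin, -Complex.ofReal_cos] using key2
      have h2e : ((1 : ℂ) + (r φ : ℂ) * Complex.exp (φ * Complex.I)) ^ n
          = ∑ k ∈ Finset.range (n + 1), ((n.choose k : ℝ) * r φ ^ k : ℝ) *
            Complex.exp ((((k : ℝ)) * φ : ℝ) * Complex.I) := by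
        rw [add_comm, add_pow]
        refine Finset.sum_congr rfl fun k _ => ?_
        rw [mul_pow, ← Complex.exp_nat_mul]
        push_cast
        rw [one_pow]
        ring_nf
      have h3e : ∑ k ∈ Finset.range (n + 1), ((n.choose k : ℝ) * r φ ^ k : ℝ) *
            Complex.exp ((((k : ℝ) - x) * φ : ℝ) * Complex.I)
          = ((1 : ℂ) + (r φ : ℂ) * Complex.exp (φ * Complex.I)) ^ n *
            Complex.exp (-(x * φ : ℝ) * Complex.I) := by
        rw [h2e, Finset.sum_mul]
        refine Finset.sum_congr rfl fun k _ => ?_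
        rw [mul_assoc, ← Complex.exp_add]
        congr 2
        push_cast; ring
      rw [h3e, h1e, mul_pow, ← Complex.exp_nat_mul, mul_assoc, ← Complex.exp_add]
      have : (n : ℂ) * ((α * φ : ℝ) * Complex.I) + -(x * φ : ℝ) * Complex.I = 0 := by
        rw [hx]; push_cast; ring
      rw [this, Complex.exp_zero, mul_one]
      push_cast; rfl
    have him := congrArg Complex.im hc
    have hre := congrArg Complex.re hc
    simp only [Complex.im_sum, Complex.re_sum, Complex.re_ofReal_mul, Complex.im_ofReal_mul,
      Complex.exp_ofReal_mul_I_re, Complex.exp_ofReal_mul_I_im, Complex.ofReal_re,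
      Complex.ofReal_im] at him hre
    rw [him, hre, mul_zero, zero_add, req φ hφ]
    simp only [hD]
    rw [Real.rpow_neg (by positivity), Real.div_rpow s2.le s3.le, div_pow,
      show (1 - α) * n = n - x by rw [hx]; ring, Real.rpow_sub s3, Real.rpow_natCast]
    field_simp
  have hint : IntervalIntegrable D volume 0 Real.pi := by
    rw [intervalIntegrable_iff_integrableOn_Ioc_of_le hpi.le]
    exact intervalIntegral.integrableOn_deriv_of_nonneg hFc hderiv hDnn
  refine ⟨hint, ?_⟩
  rw [intervalIntegral.integral_eq_sub_of_hasDerivAt_of_le hpi.le hFc hderiv hint]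
  have hF0 : F 0 = 0 := by simp [hF]
  have hrpi : r Real.pi = 1 := by
    have e := Real.sin_pi_sub (α * Real.pi)
    have : (1 - α) * Real.pi = Real.pi - α * Real.pi := by ring
    have hpos : 0 < Real.sin (α * Real.pi) :=
      Real.sin_pos_of_pos_of_lt_pi (by positivity) (by nlinarith)
    simp only [hr]
    rw [Real.sinc_of_ne_zero (by positivity), Real.sinc_of_ne_zero (by positivity), this, e]
    have : Real.pi - α * Real.pi ≠ 0 := by nlinarith
    field_simp
  have := sum_choose_sinc n (α * n)
  rw [hF0, sub_zero, show (1 : ℝ) + (1 - α) * n = 1 + n - α * n by ring, ← this]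
  simp only [hF, hrpi, Real.one_rpow, one_mul]
  rw [Finset.mul_sum]
  exact Finset.sum_congr rfl fun k _ => by ring

/-- The kernel is positive on `(0, π)`. -/
theorem zolotarevKernel_pos {α φ : ℝ} (h0 : 0 < α) (h1 : α < 1) (hφ : φ ∈ Ioo 0 Real.pi) :
    0 < zolotarevKernel α φ := by
  have hβ : 0 < 1 - α := by linarith
  have s1 : 0 < Real.sin φ := Real.sin_pos_of_pos_of_lt_pi hφ.1 hφ.2
  have s2 : 0 < Real.sin (α * φ) :=
    Real.sin_pos_of_pos_of_lt_pi (mul_pos h0 hφ.1) (by nlinarith [hφ.2, hφ.1])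
  have s3 : 0 < Real.sin ((1 - α) * φ) :=
    Real.sin_pos_of_pos_of_lt_pi (mul_pos hβ hφ.1) (by nlinarith [hφ.2, hφ.1])
  unfold zolotarevKernel; positivity

theorem measurable_zolotarevKernel (α : ℝ) : Measurable (zolotarevKernel α) := by
  unfold zolotarevKernel; fun_prop

theorem integrable_zolotarevKernel {α c : ℝ} (h0 : 0 < α) (h1 : α < 1) (hc : 0 < c) :
    IntegrableOn (fun φ => zolotarevKernel α φ * Real.exp (-zolotarevKernel α φ * c))
      (Ioo 0 Real.pi) := by
  have hm := measurable_zolotarevKernel α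
  refine Measure.integrableOn_of_bounded (M := 1 / c) (by simp) ?_ ?_
  · exact Measurable.aestronglyMeasurable (by fun_prop)
  · refine (ae_restrict_iff' measurableSet_Ioo).mpr (Eventually.of_forall fun φ hφ => ?_)
    have hk := zolotarevKernel_pos h0 h1 hφ
    rw [Real.norm_of_nonneg (by positivity), neg_mul, Real.exp_neg, ← div_eq_mul_inv,
      div_le_div_iff₀ (Real.exp_pos _) hc]
    linarith [Real.add_one_le_exp (zolotarevKernel α φ * c)]

theorem measurable_wrightDensity (α : ℝ) : Measurable (wrightDensity α) := by
  have hm := measurable_zolotarevKernel α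
  refine Measurable.mul (by fun_prop) (StronglyMeasurable.measurable ?_)
  refine StronglyMeasurable.integral_prod_right (f := fun (θ φ : ℝ) => zolotarevKernel α φ *
    Real.exp (-zolotarevKernel α φ * θ ^ (1 / (1 - α)))) (Measurable.stronglyMeasurable ?_)
  unfold Function.uncurry
  fun_prop

/-- `h_α > 0` on `(0, ∞)`. -/
theorem wrightDensity_pos {α θ : ℝ} (h0 : 0 < α) (h1 : α < 1) (hθ : 0 < θ) :
    0 < wrightDensity α θ := by
  have hβ : 0 < 1 - α := by linarith
  have hpi := Real.pi_pos
  refine mul_pos (by positivity) ?_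
  rw [setIntegral_pos_iff_support_of_nonneg_ae]
  · refine lt_of_lt_of_le ?_ (measure_mono (s := Ioo 0 Real.pi) fun φ hφ => ⟨?_, hφ⟩)
    · simp [hpi]
    · exact (mul_pos (zolotarevKernel_pos h0 h1 hφ) (Real.exp_pos _)).ne'
  · refine (ae_restrict_iff' measurableSet_Ioo).mpr (Eventually.of_forall fun φ hφ => ?_)
    exact (mul_pos (zolotarevKernel_pos h0 h1 hφ) (Real.exp_pos _)).le
  · exact integrable_zolotarevKernel h0 h1 (by positivity)

/-- Integer moments: `∫ θⁿ h_α(θ) dθ = Γ(1 + n) / Γ(1 + α n)`; for `n = 0` this says that `h_α` is a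
probability density. -/
theorem lintegral_wrightDensity_pow {α : ℝ} (h0 : 0 < α) (h1 : α < 1) (n : ℕ) :
    ∫⁻ θ in Ioi (0 : ℝ), ENNReal.ofReal (wrightDensity α θ * θ ^ n)
      = ENNReal.ofReal (Real.Gamma (n + 1) * (Real.Gamma (1 + α * n))⁻¹) := by
  have hβ : 0 < 1 - α := by linarith
  have hpi := Real.pi_pos
  have hm := measurable_zolotarevKernel α
  set f : ℝ → ℝ → ℝ := fun θ φ => θ ^ ((n : ℝ) + α / (1 - α)) *
    Real.exp (-zolotarevKernel α φ * θ ^ (1 / (1 - α))) *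
      (zolotarevKernel α φ / (Real.pi * (1 - α))) with hf
  have e1 : ∀ θ ∈ Ioi (0 : ℝ), ENNReal.ofReal (wrightDensity α θ * θ ^ n)
      = ∫⁻ φ in Ioo 0 Real.pi, ENNReal.ofReal (f θ φ) := by
    intro θ hθ
    have hθ' : 0 < θ := hθ
    have hi := integrable_zolotarevKernel h0 h1 (c := θ ^ (1 / (1 - α))) (by positivity)
    have : ∀ φ, f θ φ = (θ ^ n * (θ ^ (α / (1 - α)) / (Real.pi * (1 - α)))) *
        (zolotarevKernel α φ * Real.exp (-zolotarevKernel α φ * θ ^ (1 / (1 - α)))) := by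
      intro φ
      simp only [hf]
      rw [Real.rpow_add hθ', Real.rpow_natCast]; ring
    simp only [this]
    rw [← ofReal_integral_eq_lintegral_ofReal (hi.const_mul _), integral_const_mul]
    · congr 1; unfold wrightDensity; ring
    · refine (ae_restrict_iff' measurableSet_Ioo).mpr (Eventually.of_forall fun φ hφ => ?_)
      have := zolotarevKernel_pos h0 h1 hφ
      simp only [Pi.zero_apply]; positivity
  rw [setLIntegral_congr_fun measurableSet_Ioi e1, lintegral_lintegral_swap]
  swap
  · refine Measurable.aemeasurable ?_
    simp only [hf]; unfold Function.uncurry; fun_prop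
  have e2 : ∀ φ ∈ Ioo 0 Real.pi, ∫⁻ θ in Ioi (0 : ℝ), ENNReal.ofReal (f θ φ)
      = ENNReal.ofReal (Real.Gamma (1 + (1 - α) * n) / Real.pi * (Real.sin φ ^ n /
        (Real.sin ((1 - α) * φ) ^ ((1 - α) * n) * Real.sin (α * φ) ^ (α * n)))) := by
    intro φ hφ
    have hk := zolotarevKernel_pos h0 h1 hφ
    have s1 : 0 < Real.sin φ := Real.sin_pos_of_pos_of_lt_pi hφ.1 hφ.2
    have s2 : 0 < Real.sin (α * φ) :=
      Real.sin_pos_of_pos_of_lt_pi (mul_pos h0 hφ.1) (by nlinarith [hφ.2, hφ.1])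
    have s3 : 0 < Real.sin ((1 - α) * φ) :=
      Real.sin_pos_of_pos_of_lt_pi (mul_pos hβ hφ.1) (by nlinarith [hφ.2, hφ.1])
    have hq : -1 < (n : ℝ) + α / (1 - α) := by
      have : 0 ≤ (n : ℝ) + α / (1 - α) := by positivity
      linarith
    have hI := integral_rpow_mul_exp_neg_mul_rpow (p := 1 / (1 - α)) (by positivity) hq hk
    have hex : ((n : ℝ) + α / (1 - α) + 1) / (1 / (1 - α)) = 1 + (1 - α) * n := by
      field_simp; ring
    have hex' : -((n : ℝ) + α / (1 - α) + 1) / (1 / (1 - α)) = -1 + -((1 - α) * n) := by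
      rw [neg_div, hex]; ring
    rw [hex, hex'] at hI
    have hG : 0 < Real.Gamma (1 + (1 - α) * n) := Real.Gamma_pos_of_pos (by positivity)
    have hint := Integrable.of_integral_ne_zero (hI ▸ (by positivity :
      (zolotarevKernel α φ) ^ (-1 + -((1 - α) * (n : ℝ))) * (1 / (1 / (1 - α))) *
        Real.Gamma (1 + (1 - α) * n) ≠ 0))
    simp only [hf]
    rw [← ofReal_integral_eq_lintegral_ofReal (hint.mul_const _), integral_mul_const, hI]
    · congr 1
      have hpow : zolotarevKernel α φ ^ (-((1 - α) * (n : ℝ))) = Real.sin φ ^ n /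
          (Real.sin ((1 - α) * φ) ^ ((1 - α) * n) * Real.sin (α * φ) ^ (α * n)) := by
        unfold zolotarevKernel
        rw [Real.rpow_neg (by positivity), Real.div_rpow (by positivity) (by positivity),
          Real.mul_rpow (by positivity) (by positivity), ← Real.rpow_mul s2.le,
          ← Real.rpow_mul s1.le, inv_div]
        rw [show α / (1 - α) * ((1 - α) * n) = α * n by field_simp,
          show 1 / (1 - α) * ((1 - α) * n) = (n : ℝ) by field_simp, Real.rpow_natCast]
      rw [Real.rpow_add hk, hpow, Real.rpow_neg_one]
      field_simp
    · refine (ae_restrict_iff' measurableSet_Ioi).mpr (Eventually.of_forall fun θ hθ => ?_)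
      have hθ' : (0 : ℝ) < θ := hθ
      simp only [Pi.zero_apply]; positivity
  obtain ⟨hDi, hDv⟩ := integral_kernel_pow h0 h1 n
  rw [intervalIntegrable_iff_integrableOn_Ioo_of_le hpi.le] at hDi
  rw [intervalIntegral.integral_of_le hpi.le, integral_Ioc_eq_integral_Ioo] at hDv
  rw [setLIntegral_congr_fun measurableSet_Ioo e2,
    ← ofReal_integral_eq_lintegral_ofReal (hDi.const_mul _), integral_const_mul, hDv]
  · congr 1
    have hG : 0 < Real.Gamma (1 + (1 - α) * n) := Real.Gamma_pos_of_pos (by positivity)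
    field_simp
  · refine (ae_restrict_iff' measurableSet_Ioo).mpr (Eventually.of_forall fun φ hφ => ?_)
    have s1 : 0 < Real.sin φ := Real.sin_pos_of_pos_of_lt_pi hφ.1 hφ.2
    have s2 : 0 < Real.sin (α * φ) :=
      Real.sin_pos_of_pos_of_lt_pi (mul_pos h0 hφ.1) (by nlinarith [hφ.2, hφ.1])
    have s3 : 0 < Real.sin ((1 - α) * φ) :=
      Real.sin_pos_of_pos_of_lt_pi (mul_pos hβ hφ.1) (by nlinarith [hφ.2, hφ.1])
    have hG : 0 < Real.Gamma (1 + (1 - α) * n) := Real.Gamma_pos_of_pos (by positivity)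
    simp only [Pi.zero_apply]; positivity

theorem summable_pow_mul_inv_Gamma {α : ℝ} (h0 : 0 < α) (R : ℝ) (hR : 0 ≤ R) :
    Summable fun n : ℕ => R ^ n * (Real.Gamma (1 + α * n))⁻¹ := by
  set K : ℝ := (2 * (R + 1)) ^ (1 / α) with hK
  have hKpos : 0 < K := by positivity
  have hKα : K ^ α = 2 * (R + 1) := by
    rw [hK, ← Real.rpow_mul (by positivity), one_div, inv_mul_cancel₀ h0.ne', Real.rpow_one]
  have hlow : ∀ n : ℕ, Real.exp (-K) * (2 * (R + 1)) ^ n ≤ Real.Gamma (1 + α * n) := by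
    intro n
    have hs : (0 : ℝ) < 1 + α * n := by positivity
    have hconv := Real.GammaIntegral_convergent hs
    rw [Real.Gamma_eq_integral hs]
    calc Real.exp (-K) * (2 * (R + 1)) ^ n
        = ∫ x in Ioi K, Real.exp (-x) * K ^ (α * n) := by
          rw [integral_mul_const, integral_exp_neg_Ioi, Real.rpow_mul hKpos.le, hKα,
            Real.rpow_natCast]
      _ ≤ ∫ x in Ioi K, Real.exp (-x) * x ^ (1 + α * n - 1) := by
          refine setIntegral_mono_on ((integrableOn_exp_neg_Ioi K).mul_const _)
            (hconv.mono_set (Ioi_subset_Ioi hKpos.le)) measurableSet_Ioi fun x hx => ?_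
          have : K ≤ x := (mem_Ioi.mp hx).le
          rw [add_sub_cancel_left]
          gcongr
      _ ≤ _ := by
          refine setIntegral_mono_set hconv ?_ (Ioi_subset_Ioi hKpos.le).eventuallyLE
          refine (ae_restrict_iff' measurableSet_Ioi).mpr (Eventually.of_forall fun x hx => ?_)
          have : (0 : ℝ) < x := hx
          simp only [Pi.zero_apply]; positivity
  refine Summable.of_nonneg_of_le (fun n => ?_) (fun n => ?_)
    ((summable_geometric_two).mul_left (Real.exp K))
  · have : 0 < Real.Gamma (1 + α * n) := Real.Gamma_pos_of_pos (by positivity)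
    positivity
  · have hG : 0 < Real.Gamma (1 + α * n) := Real.Gamma_pos_of_pos (by positivity)
    rw [← div_eq_mul_inv, div_le_iff₀ hG]
    calc R ^ n ≤ (R + 1) ^ n := by gcongr; linarith
      _ = Real.exp K * (1 / 2) ^ n * (Real.exp (-K) * (2 * (R + 1)) ^ n) := by
          rw [mul_pow, Real.exp_neg, one_div, inv_pow]
          field_simp
      _ ≤ _ := by gcongr; exact hlow n

/-- `∫ h_α(θ) e^{zθ} dθ = E_{α,1}(z)` for every complex `z`; this identity determines the continuous
function `h_α` on `(0, ∞)`. -/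
theorem integral_wrightDensity_mul_exp {α : ℝ} (h0 : 0 < α) (h1 : α < 1) (z : ℂ) :
    ∫ θ in Ioi (0 : ℝ), (wrightDensity α θ : ℂ) * Complex.exp (z * θ) = mittagLeffler α 1 z := by
  have hm := measurable_wrightDensity α
  set g : ℕ → ℝ → ℝ := fun n θ => wrightDensity α θ * θ ^ n with hg
  have gnn : ∀ n, 0 ≤ᵐ[volume.restrict (Ioi 0)] g n := fun n =>
    (ae_restrict_iff' measurableSet_Ioi).mpr (Eventually.of_forall fun θ hθ => by
      have := wrightDensity_pos h0 h1 hθ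
      have : (0 : ℝ) < θ := hθ
      simp only [hg, Pi.zero_apply]; positivity)
  have gmeas : ∀ n, AEStronglyMeasurable (g n) (volume.restrict (Ioi 0)) := fun n =>
    Measurable.aestronglyMeasurable (by simp only [hg]; fun_prop)
  have Gpos : ∀ n : ℕ, 0 < Real.Gamma (1 + α * n) := fun n => Real.Gamma_pos_of_pos (by positivity)
  have Gpos' : ∀ n : ℕ, 0 < Real.Gamma ((n : ℝ) + 1) := fun n =>
    Real.Gamma_pos_of_pos (by positivity)
  have gint : ∀ n, IntegrableOn (g n) (Ioi 0) := fun n => by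
    refine ⟨gmeas n, ?_⟩
    rw [hasFiniteIntegral_iff_ofReal (gnn n), lintegral_wrightDensity_pow h0 h1 n]
    exact ENNReal.ofReal_lt_top
  have gval : ∀ n : ℕ, ∫ θ in Ioi (0 : ℝ), g n θ
      = Real.Gamma (n + 1) * (Real.Gamma (1 + α * n))⁻¹ := fun n => by
    rw [integral_eq_lintegral_of_nonneg_ae (gnn n) (gmeas n), lintegral_wrightDensity_pow h0 h1 n,
      ENNReal.toReal_ofReal]
    have := Gpos n; have := Gpos' n; positivity
  set F : ℕ → ℝ → ℂ := fun n θ => (z ^ n / (n.factorial : ℂ)) * (g n θ : ℂ) with hF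
  have Fint : ∀ n, Integrable (F n) (volume.restrict (Ioi 0)) := fun n =>
    (gint n).ofReal.const_mul _
  have Fval : ∀ n : ℕ, ∫ θ in Ioi (0 : ℝ), F n θ
      = z ^ n / Complex.Gamma ((α : ℂ) * n + (1 : ℝ)) := fun n => by
    simp only [hF]
    rw [integral_const_mul, integral_complex_ofReal, gval, Real.Gamma_nat_eq_factorial]
    have e : (α : ℂ) * n + (1 : ℝ) = ((1 + α * n : ℝ) : ℂ) := by push_cast; ring
    rw [e, Complex.Gamma_ofReal]
    have : ((n.factorial : ℕ) : ℂ) ≠ 0 := by exact_mod_cast n.factorial_ne_zero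
    push_cast
    field_simp
  have Fnorm : ∀ n : ℕ, ∫ θ in Ioi (0 : ℝ), ‖F n θ‖ = ‖z‖ ^ n * (Real.Gamma (1 + α * n))⁻¹ := by
    intro n
    have : ∀ᵐ θ ∂volume.restrict (Ioi (0 : ℝ)), ‖F n θ‖ = ‖z‖ ^ n / n.factorial * g n θ := by
      filter_upwards [gnn n] with θ hθ
      simp only [hF, norm_mul, norm_div, norm_pow, Complex.norm_natCast, Complex.norm_real]
      rw [Real.norm_of_nonneg hθ]
    rw [integral_congr_ae this, integral_const_mul, gval, Real.Gamma_nat_eq_factorial]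
    have : ((n.factorial : ℕ) : ℝ) ≠ 0 := by exact_mod_cast n.factorial_ne_zero
    field_simp
  have hsum : Summable fun n => ∫ θ in Ioi (0 : ℝ), ‖F n θ‖ := by
    simp only [Fnorm]; exact summable_pow_mul_inv_Gamma h0 _ (norm_nonneg z)
  have hpt : ∀ θ : ℝ, ∑' n, F n θ = (wrightDensity α θ : ℂ) * Complex.exp (z * θ) := by
    intro θ
    have h := (NormedSpace.expSeries_div_hasSum_exp (𝔸 := ℂ) (z * θ)).mul_left (wrightDensity α θ : ℂ)
    rw [← Complex.exp_eq_exp_ℂ] at h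
    rw [← h.tsum_eq]
    refine tsum_congr fun n => ?_
    simp only [hF, hg]
    push_cast
    ring
  have key := hasSum_integral_of_summable_integral_norm Fint hsum
  simp only [hpt] at key
  rw [← key.tsum_eq]
  unfold mittagLeffler
  exact tsum_congr Fval

/-- The integral in the previous identity converges absolutely. -/
theorem integrableOn_wrightDensity_mul_exp {α : ℝ} (h0 : 0 < α) (h1 : α < 1) (z : ℂ) :
    IntegrableOn (fun θ : ℝ => (wrightDensity α θ : ℂ) * Complex.exp (z * θ)) (Ioi 0) := by
  have hm := measurable_wrightDensity α
  have hs := summable_pow_mul_inv_Gamma h0 _ (norm_nonneg z)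
  have hML : mittagLeffler α 1 (‖z‖ : ℂ)
      = ((∑' n : ℕ, ‖z‖ ^ n * (Real.Gamma (1 + α * n))⁻¹ : ℝ) : ℂ) := by
    unfold mittagLeffler
    rw [Complex.ofReal_tsum]
    refine tsum_congr fun n => ?_
    have e : (α : ℂ) * n + (1 : ℝ) = ((1 + α * n : ℝ) : ℂ) := by push_cast; ring
    rw [e, Complex.Gamma_ofReal]
    push_cast
    rw [div_eq_mul_inv]
  have hpos : 0 < ∑' n : ℕ, ‖z‖ ^ n * (Real.Gamma (1 + α * n))⁻¹ := by
    refine hs.tsum_pos (fun n => ?_) 0 (by simp)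
    have : 0 < Real.Gamma (1 + α * n) := Real.Gamma_pos_of_pos (by positivity)
    positivity
  have hne : ∫ θ in Ioi (0 : ℝ), (wrightDensity α θ : ℂ) * Complex.exp (‖z‖ * θ) ≠ 0 := by
    rw [integral_wrightDensity_mul_exp h0 h1, hML]
    exact_mod_cast hpos.ne'
  refine (Integrable.of_integral_ne_zero hne).mono
    (Measurable.aestronglyMeasurable (by fun_prop)) ?_
  refine (ae_restrict_iff' measurableSet_Ioi).mpr (Eventually.of_forall fun θ hθ => ?_)
  rw [norm_mul, norm_mul, Complex.norm_exp, Complex.norm_exp]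
  have hθ' : (0 : ℝ) < θ := hθ
  have : (z * θ).re ≤ ((‖z‖ : ℂ) * θ).re := by
    simp only [Complex.re_mul_ofReal, Complex.ofReal_re]
    gcongr
    exact Complex.re_le_norm z
  gcongr

/-- Euclidean space `ℝᴺ`. -/
abbrev Space (N : ℕ) : Type := EuclideanSpace ℝ (Fin N)

/-- The heat kernel `G(t, x) = (4πt)^{-N/2} exp(-|x|² / (4t))`. -/
noncomputable def heatKernel {N : ℕ} (t : ℝ) (x : Space N) : ℝ :=
  1 / (4 * Real.pi * t) ^ ((N : ℝ) / 2) * Real.exp (-‖x‖ ^ 2 / (4 * t))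

/-- `(e^{tΔ} μ)(x) = ∫ G(t, x - y) dμ(y)`, with values in `[0, ∞]`. -/
noncomputable def heatSemigroup {N : ℕ} (t : ℝ) (μ : Measure (Space N)) (x : Space N) : ℝ≥0∞ :=
  ∫⁻ y, ENNReal.ofReal (heatKernel t (x - y)) ∂μ

/-- `P_α(t) μ = ∫₀^∞ h_α(θ) e^{t^α θ Δ} μ dθ`. -/
noncomputable def opP {N : ℕ} (α t : ℝ) (μ : Measure (Space N)) (x : Space N) : ℝ≥0∞ :=
  ∫⁻ θ in Ioi (0 : ℝ), ENNReal.ofReal (wrightDensity α θ) * heatSemigroup (t ^ α * θ) μ x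

/-- `S_α(t) μ = ∫₀^∞ θ h_α(θ) e^{t^α θ Δ} μ dθ`. -/
noncomputable def opS {N : ℕ} (α t : ℝ) (μ : Measure (Space N)) (x : Space N) : ℝ≥0∞ :=
  ∫⁻ θ in Ioi (0 : ℝ), ENNReal.ofReal (θ * wrightDensity α θ) * heatSemigroup (t ^ α * θ) μ x

/-- `u` is a (nonnegative, mild) solution on `[0, T] × ℝᴺ` of `∂ₜ^α u - Δu = u^p`, `u(0) = μ`:
`∞ > u(t, x) = [P_α(t) μ](x) + α ∫₀ᵗ (t - s)^{α - 1} [S_α(t - s) u(s)^p](x) ds` for almost all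
`t ∈ (0, T]` and `x ∈ ℝᴺ`. A function `f ≥ 0` is identified with the measure `f dx`. Values of `u`
outside `(0, T] × ℝᴺ` are irrelevant. -/
def IsSolution {N : ℕ} (α p T : ℝ) (μ : Measure (Space N)) (u : ℝ → Space N → ℝ≥0∞) : Prop :=
  Measurable (fun z : ℝ × Space N => u z.1 z.2) ∧
  ∀ᵐ t : ℝ, t ∈ Ioc 0 T → ∀ᵐ x : Space N,
    u t x < ∞ ∧
    u t x = opP α t μ x +
      ENNReal.ofReal α * ∫⁻ s in Ioo 0 t, ENNReal.ofReal ((t - s) ^ (α - 1)) *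
        opS α (t - s) (volume.withDensity fun y => u s y ^ p) x

/-- A global-in-time solution: a solution on `[0, T] × ℝᴺ` for every finite `T > 0`. -/
def IsGlobalSolution {N : ℕ} (α p : ℝ) (μ : Measure (Space N)) (u : ℝ → Space N → ℝ≥0∞) : Prop :=
  ∀ T : ℝ, 0 < T → IsSolution α p T μ u

/-- `B⁺(r)`: nonnegative finite (Borel, hence Radon) measures on `ℝᴺ` of total mass at most `r`. -/
def posBall (N : ℕ) (r : ℝ) : Set (Measure (Space N)) :=
  {μ | IsFiniteMeasure μ ∧ μ univ ≤ ENNReal.ofReal r}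

/-- `G_α`: nonnegative finite measures on `ℝᴺ` for which the problem with exponent `p` possesses a
global-in-time solution. -/
def globalData (N : ℕ) (α p : ℝ) : Set (Measure (Space N)) :=
  {ν | IsFiniteMeasure ν ∧ ∃ u : ℝ → Space N → ℝ≥0∞, IsGlobalSolution α p ν u}

/-- The Fujita exponent `p_F = 1 + 2/N`. -/
noncomputable def fujitaExponent (N : ℕ) : ℝ := 1 + 2 / (N : ℝ)

end TimeFracHeat

/-!
Criticality `N / 2 * (p - 1) = 1` makes both halves of the argument scale invariant, and in each
of them a factor `1 / (1 - α)` comes from integrating an otherwise harmless power of time.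

*Small data.* The integral equation is solved by monotone iteration in the norm
`sup_t t ^ (α / p) * ‖u t‖_p`. The Duhamel term acts on the ball of radius `2 m C` by a Beta
integral of size `1 / (1 - α)`, so the iteration stays bounded as soon as `m ^ (p - 1)` is at most
a small multiple of `1 - α`, where `m` is the mass of the datum.

*Large data.* A datum of mass `m` forces `u t x ≥ A * t ^ (-α N / 2)` on the parabolic region
`|x| ≤ t ^ (α / 2)`, with `A` comparable to `m`. Inserting this bound into the Duhamel term
returns a bound of the same form: near `s = 0` the spatial integral of `u s ^ p` is of order
`s ^ (-α)`, whose time integral contributes `1 / (1 - α)`. If `A ^ (p - 1)` exceeds a large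
multiple of `1 - α`, the amplitude doubles, and iterating makes it arbitrarily large at later
times. Once it is large compared with an absolute constant, `u ≥ D` on a ball improves
geometrically over a geometric sequence of shrinking time steps, so `u = ∞` on a set of positive
measure.
-/

namespace TimeFracHeat

/-! ### Minkowski's integral inequality -/

section Minkowski

variable {Θ X : Type*} [MeasurableSpace Θ] [MeasurableSpace X] {ν : Measure Θ} {μ : Measure X}
  {p : ℝ} {b : Θ → ℝ≥0∞}

theorem rpow_lintegral_le_rpow_mul_lintegral (hp : 1 < p) {f : Θ → ℝ≥0∞} (hf : Measurable f)
    (hb : Measurable b) (hb0 : ∀ᵐ θ ∂ν, b θ ≠ 0) (hbt : ∀ᵐ θ ∂ν, b θ ≠ ∞) :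
    (∫⁻ θ, f θ ∂ν) ^ p ≤ (∫⁻ θ, b θ ∂ν) ^ (p - 1) * ∫⁻ θ, b θ ^ (1 - p) * f θ ^ p ∂ν := by
  have hp0 : 0 < p := by linarith
  have hq := Real.HolderConjugate.conjExponent hp
  set q := p.conjExponent
  have hq0 : 0 < q := hq.symm.pos
  have hqp : 1 / q * p = p - 1 := by
    rw [one_div, ← hq.one_sub_inv]; field_simp
  have hsplit : ∫⁻ θ, f θ ∂ν = ∫⁻ θ, b θ ^ (1 / q) * (b θ ^ (-(1 / q)) * f θ) ∂ν := by
    refine lintegral_congr_ae ?_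
    filter_upwards [hb0, hbt] with θ h0 ht
    rw [← mul_assoc, ← ENNReal.rpow_add _ _ h0 ht, add_neg_cancel, ENNReal.rpow_zero, one_mul]
  have hHolder := ENNReal.lintegral_mul_le_Lp_mul_Lq ν hq.symm
    (hb.pow_const (1 / q)).aemeasurable ((hb.pow_const (-(1 / q))).mul hf).aemeasurable
  have hleft : ∀ θ, (b θ ^ (1 / q)) ^ q = b θ := fun θ => by
    rw [← ENNReal.rpow_mul, one_div_mul_cancel hq0.ne', ENNReal.rpow_one]
  have hright : ∀ θ, (b θ ^ (-(1 / q)) * f θ) ^ p = b θ ^ (1 - p) * f θ ^ p := fun θ => by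
    rw [ENNReal.mul_rpow_of_nonneg _ _ hp0.le, ← ENNReal.rpow_mul, neg_mul, hqp, neg_sub]
  calc (∫⁻ θ, f θ ∂ν) ^ p
      ≤ ((∫⁻ θ, (b θ ^ (1 / q)) ^ q ∂ν) ^ (1 / q) *
          (∫⁻ θ, (b θ ^ (-(1 / q)) * f θ) ^ p ∂ν) ^ (1 / p)) ^ p := by
        rw [hsplit]; exact ENNReal.rpow_le_rpow hHolder hp0.le
    _ = (∫⁻ θ, b θ ∂ν) ^ (p - 1) * ∫⁻ θ, b θ ^ (1 - p) * f θ ^ p ∂ν := by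
        simp only [hleft, hright]
        rw [ENNReal.mul_rpow_of_nonneg _ _ hp0.le, ← ENNReal.rpow_mul, ← ENNReal.rpow_mul, hqp,
          one_div_mul_cancel hp0.ne', ENNReal.rpow_one]

variable [SFinite ν] [SFinite μ]

theorem lintegral_rpow_lintegral_le (hp : 1 < p) {F : Θ → X → ℝ≥0∞}
    (hF : Measurable (Function.uncurry F)) (hb : Measurable b)
    (hb0 : ∀ᵐ θ ∂ν, b θ ≠ 0) (hbt : ∀ᵐ θ ∂ν, b θ ≠ ∞)
    (hFb : ∀ᵐ θ ∂ν, ∫⁻ x, F θ x ^ p ∂μ ≤ b θ ^ p) :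
    ∫⁻ x, (∫⁻ θ, F θ x ∂ν) ^ p ∂μ ≤ (∫⁻ θ, b θ ∂ν) ^ p := by
  have hmeas : Measurable (Function.uncurry fun x θ => b θ ^ (1 - p) * F θ x ^ p) :=
    ((hb.comp measurable_snd).pow_const _).mul ((hF.comp measurable_swap).pow_const _)
  calc ∫⁻ x, (∫⁻ θ, F θ x ∂ν) ^ p ∂μ
      ≤ ∫⁻ x, (∫⁻ θ, b θ ∂ν) ^ (p - 1) * ∫⁻ θ, b θ ^ (1 - p) * F θ x ^ p ∂ν ∂μ :=
        lintegral_mono fun x => rpow_lintegral_le_rpow_mul_lintegral hp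
          (hF.comp measurable_prodMk_right) hb hb0 hbt
    _ = (∫⁻ θ, b θ ∂ν) ^ (p - 1) * ∫⁻ θ, ∫⁻ x, b θ ^ (1 - p) * F θ x ^ p ∂μ ∂ν := by
        rw [← lintegral_lintegral_swap hmeas.aemeasurable]
        exact lintegral_const_mul _ hmeas.lintegral_prod_right'
    _ ≤ (∫⁻ θ, b θ ∂ν) ^ (p - 1) * ∫⁻ θ, b θ ∂ν := by
        refine mul_le_mul_right (lintegral_mono_ae ?_) _
        filter_upwards [hb0, hbt, hFb] with θ h0 ht h
        have hFθ : Measurable (F θ) := hF.comp measurable_prodMk_left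
        rw [lintegral_const_mul _ (hFθ.pow_const p)]
        calc b θ ^ (1 - p) * ∫⁻ x, F θ x ^ p ∂μ ≤ b θ ^ (1 - p) * b θ ^ p := by gcongr
          _ = b θ := by rw [← ENNReal.rpow_add _ _ h0 ht, sub_add_cancel, ENNReal.rpow_one]
    _ = (∫⁻ θ, b θ ∂ν) ^ p := by
        nth_rewrite 2 [← ENNReal.rpow_one (∫⁻ θ, b θ ∂ν)]
        rw [← ENNReal.rpow_add_of_nonneg _ _ (by linarith) zero_le_one, sub_add_cancel]

theorem lintegral_rpow_lintegral_mul_le (hp : 1 < p) {w : Θ → ℝ≥0∞} (hw : Measurable w)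
    {F : Θ → X → ℝ≥0∞} (hF : Measurable (Function.uncurry F)) (hb : Measurable b)
    (hb0 : ∀ᵐ θ ∂ν, b θ ≠ 0) (hbt : ∀ᵐ θ ∂ν, b θ ≠ ∞)
    (hFb : ∀ᵐ θ ∂ν, ∫⁻ x, F θ x ^ p ∂μ ≤ b θ ^ p) :
    ∫⁻ x, (∫⁻ θ, w θ * F θ x ∂ν) ^ p ∂μ ≤ (∫⁻ θ, w θ * b θ ∂ν) ^ p := by
  have hac := withDensity_absolutelyContinuous ν w
  have h := lintegral_rpow_lintegral_le (ν := ν.withDensity w) (μ := μ) hp hF hb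
    (hac.ae_le hb0) (hac.ae_le hbt) (hac.ae_le hFb)
  rw [lintegral_withDensity_eq_lintegral_mul _ hw hb] at h
  refine le_trans (le_of_eq (lintegral_congr fun x => ?_)) h
  have hFx : Measurable fun θ => F θ x := hF.comp measurable_prodMk_right
  rw [lintegral_withDensity_eq_lintegral_mul _ hw hFx]
  rfl

end Minkowski

/-! ### The heat kernel and its subordinations -/

section Heat

variable {N : ℕ}

@[fun_prop]
theorem measurable_heatKernel : Measurable fun z : ℝ × Space N => heatKernel z.1 z.2 := by
  unfold heatKernel; fun_prop

theorem heatKernel_pos {t : ℝ} (ht : 0 < t) (x : Space N) : 0 < heatKernel t x := by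
  unfold heatKernel; positivity

theorem heatKernel_le {t : ℝ} (ht : 0 < t) (x : Space N) :
    heatKernel t x ≤ t ^ (-((N : ℝ) / 2)) := by
  have hexp : Real.exp (-‖x‖ ^ 2 / (4 * t)) ≤ 1 :=
    Real.exp_le_one_iff.mpr (div_nonpos_of_nonpos_of_nonneg (by simp) (by positivity))
  calc heatKernel t x ≤ 1 / (4 * Real.pi * t) ^ ((N : ℝ) / 2) :=
        mul_le_of_le_one_right (by positivity) hexp
    _ = (4 * Real.pi * t) ^ (-((N : ℝ) / 2)) := by
        rw [Real.rpow_neg (by positivity), one_div]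
    _ ≤ t ^ (-((N : ℝ) / 2)) :=
        Real.rpow_le_rpow_of_nonpos ht (by nlinarith [Real.pi_gt_three])
          (neg_nonpos.mpr (by positivity))

theorem lintegral_heatKernel {t : ℝ} (ht : 0 < t) :
    ∫⁻ x : Space N, ENNReal.ofReal (heatKernel t x) = 1 := by
  have hnorm : (4 * Real.pi * t) ^ ((N : ℝ) / 2) ≠ 0 := by positivity
  have hgauss := GaussianFourier.integral_rexp_neg_mul_sq_norm (V := Space N)
    (show 0 < 1 / (4 * t) by positivity)
  have hbase : Real.pi / (1 / (4 * t)) = 4 * Real.pi * t := by field_simp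
  rw [hbase, finrank_euclideanSpace_fin] at hgauss
  have hint := Integrable.of_integral_ne_zero (hgauss ▸ hnorm)
  have hkernel : ∀ x : Space N, heatKernel t x
      = 1 / (4 * Real.pi * t) ^ ((N : ℝ) / 2) * Real.exp (-(1 / (4 * t)) * ‖x‖ ^ 2) := by
    intro x; unfold heatKernel; congr 2; ring
  simp only [hkernel]
  rw [← ofReal_integral_eq_lintegral_ofReal (hint.const_mul _)
    (Eventually.of_forall fun x => by simp only [Pi.zero_apply]; positivity), integral_const_mul,
    hgauss, one_div_mul_cancel hnorm, ENNReal.ofReal_one]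

/-- The exponent `γ` in the smoothing estimate `‖e^{tΔ} μ‖_p ≤ t^{-γ} μ(ℝᴺ)`. -/
noncomputable def smoothingExponent (N : ℕ) (p : ℝ) : ℝ := (N : ℝ) / 2 * (1 - 1 / p)

theorem smoothingExponent_mul {p : ℝ} (hp : p ≠ 0) :
    smoothingExponent N p * p = (N : ℝ) / 2 * (p - 1) := by
  unfold smoothingExponent; field_simp

theorem lintegral_heatKernel_rpow_le {p : ℝ} (hp : 1 ≤ p) {t : ℝ} (ht : 0 < t) (y : Space N) :
    ∫⁻ x : Space N, ENNReal.ofReal (heatKernel t (x - y)) ^ p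
      ≤ ENNReal.ofReal (t ^ (-smoothingExponent N p)) ^ p := by
  have hp0 : 0 < p := by linarith
  have hpow : ∀ x : Space N, ENNReal.ofReal (heatKernel t x) ^ p
      ≤ ENNReal.ofReal (t ^ (-((N : ℝ) / 2 * (p - 1)))) * ENNReal.ofReal (heatKernel t x) := by
    intro x
    have hpos := heatKernel_pos ht x
    rw [ENNReal.ofReal_rpow_of_nonneg hpos.le hp0.le, ← ENNReal.ofReal_mul (by positivity)]
    refine ENNReal.ofReal_le_ofReal ?_
    calc heatKernel t x ^ p = heatKernel t x ^ (p - 1) * heatKernel t x := by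
          rw [← Real.rpow_add_one hpos.ne', sub_add_cancel]
      _ ≤ (t ^ (-((N : ℝ) / 2))) ^ (p - 1) * heatKernel t x := by
          gcongr
          exact heatKernel_le ht x
      _ = _ := by rw [← Real.rpow_mul ht.le, neg_mul]
  calc ∫⁻ x : Space N, ENNReal.ofReal (heatKernel t (x - y)) ^ p
      = ∫⁻ x : Space N, ENNReal.ofReal (heatKernel t x) ^ p :=
        lintegral_sub_right_eq_self (fun x : Space N => ENNReal.ofReal (heatKernel t x) ^ p) y
    _ ≤ ∫⁻ x : Space N, ENNReal.ofReal (t ^ (-((N : ℝ) / 2 * (p - 1)))) *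
          ENNReal.ofReal (heatKernel t x) := lintegral_mono hpow
    _ = ENNReal.ofReal (t ^ (-((N : ℝ) / 2 * (p - 1)))) := by
        rw [lintegral_const_mul _ (by fun_prop), lintegral_heatKernel ht, mul_one]
    _ = _ := by
        rw [ENNReal.ofReal_rpow_of_nonneg (by positivity) hp0.le, ← Real.rpow_mul ht.le, neg_mul,
          smoothingExponent_mul hp0.ne']

/-- The heat kernel subordinated with the weight `w`, `∫₀^∞ w(θ) G(σθ, z) dθ`. -/
noncomputable def subordKernel (w : ℝ → ℝ≥0∞) (σ : ℝ) (z : Space N) : ℝ≥0∞ :=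
  ∫⁻ θ in Ioi (0 : ℝ), w θ * ENNReal.ofReal (heatKernel (σ * θ) z)

/-- The moment `∫₀^∞ w(θ) θ^{-γ} dθ` of the weight `w`. -/
noncomputable def negMoment (w : ℝ → ℝ≥0∞) (γ : ℝ) : ℝ≥0∞ :=
  ∫⁻ θ in Ioi (0 : ℝ), w θ * ENNReal.ofReal (θ ^ (-γ))

/-- The subordinating weight `h_α` of `P_α`. -/
noncomputable def weightP (α θ : ℝ) : ℝ≥0∞ := ENNReal.ofReal (wrightDensity α θ)

/-- The subordinating weight `θ h_α(θ)` of `S_α`. -/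
noncomputable def weightS (α θ : ℝ) : ℝ≥0∞ := ENNReal.ofReal (θ * wrightDensity α θ)

@[fun_prop]
theorem measurable_weightP (α : ℝ) : Measurable (weightP α) :=
  (measurable_wrightDensity α).ennreal_ofReal

@[fun_prop]
theorem measurable_weightS (α : ℝ) : Measurable (weightS α) :=
  (measurable_id.mul (measurable_wrightDensity α)).ennreal_ofReal

variable {w : ℝ → ℝ≥0∞}

@[fun_prop]
theorem measurable_subordKernel (hw : Measurable w) :
    Measurable fun z : ℝ × Space N => subordKernel w z.1 z.2 := by
  exact Measurable.lintegral_prod_right' (f := fun a : (ℝ × Space N) × ℝ =>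
    w a.2 * ENNReal.ofReal (heatKernel (a.1.1 * a.2) a.1.2)) (by fun_prop)

theorem lintegral_mul_heatSemigroup_eq (hw : Measurable w) (σ : ℝ) (μ : Measure (Space N))
    [SFinite μ] (x : Space N) :
    ∫⁻ θ in Ioi (0 : ℝ), w θ * heatSemigroup (σ * θ) μ x = ∫⁻ y, subordKernel w σ (x - y) ∂μ := by
  have hmeas : Measurable fun a : ℝ × Space N =>
      ENNReal.ofReal (heatKernel (σ * a.1) (x - a.2)) := by
    fun_prop
  calc ∫⁻ θ in Ioi (0 : ℝ), w θ * heatSemigroup (σ * θ) μ x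
      = ∫⁻ θ in Ioi (0 : ℝ), ∫⁻ y, w θ * ENNReal.ofReal (heatKernel (σ * θ) (x - y)) ∂μ :=
        lintegral_congr fun θ =>
          (lintegral_const_mul _ (hmeas.comp measurable_prodMk_left)).symm
    _ = ∫⁻ y, subordKernel w σ (x - y) ∂μ :=
        lintegral_lintegral_swap ((hw.comp measurable_fst).mul hmeas).aemeasurable

theorem opP_eq_lintegral (α t : ℝ) (μ : Measure (Space N)) [SFinite μ] (x : Space N) :
    opP α t μ x = ∫⁻ y, subordKernel (weightP α) (t ^ α) (x - y) ∂μ :=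
  lintegral_mul_heatSemigroup_eq (measurable_weightP α) _ μ x

theorem opS_eq_lintegral (α t : ℝ) (μ : Measure (Space N)) [SFinite μ] (x : Space N) :
    opS α t μ x = ∫⁻ y, subordKernel (weightS α) (t ^ α) (x - y) ∂μ :=
  lintegral_mul_heatSemigroup_eq (measurable_weightS α) _ μ x

theorem lintegral_subordKernel_rpow_le {p : ℝ} (hp : 1 < p) (hw : Measurable w) {σ : ℝ}
    (hσ : 0 < σ) (y : Space N) :
    ∫⁻ x : Space N, subordKernel w σ (x - y) ^ p
      ≤ (ENNReal.ofReal (σ ^ (-smoothingExponent N p)) *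
          negMoment w (smoothingExponent N p)) ^ p := by
  set γ := smoothingExponent N p
  have hmeas : Measurable fun a : ℝ × Space N =>
      ENNReal.ofReal (heatKernel (σ * a.1) (a.2 - y)) := by
    fun_prop
  have hpos : ∀ᵐ θ ∂volume.restrict (Ioi (0 : ℝ)), ENNReal.ofReal ((σ * θ) ^ (-γ)) ≠ 0 := by
    filter_upwards [ae_restrict_mem measurableSet_Ioi] with θ (hθ : 0 < θ)
    rw [ne_eq, ENNReal.ofReal_eq_zero, not_le]
    positivity
  have hbound : ∀ᵐ θ ∂volume.restrict (Ioi (0 : ℝ)),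
      ∫⁻ x : Space N, ENNReal.ofReal (heatKernel (σ * θ) (x - y)) ^ p
        ≤ ENNReal.ofReal ((σ * θ) ^ (-γ)) ^ p := by
    filter_upwards [ae_restrict_mem measurableSet_Ioi] with θ hθ
    exact lintegral_heatKernel_rpow_le hp.le (mul_pos hσ hθ) y
  calc ∫⁻ x : Space N, subordKernel w σ (x - y) ^ p
      ≤ (∫⁻ θ in Ioi (0 : ℝ), w θ * ENNReal.ofReal ((σ * θ) ^ (-γ))) ^ p :=
        lintegral_rpow_lintegral_mul_le hp hw
          (F := fun θ x => ENNReal.ofReal (heatKernel (σ * θ) (x - y))) hmeas (by fun_prop) hpos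
          (Eventually.of_forall fun θ => ENNReal.ofReal_ne_top) hbound
    _ = (ENNReal.ofReal (σ ^ (-γ)) * negMoment w γ) ^ p := by
        unfold negMoment
        rw [← lintegral_const_mul _ (by fun_prop)]
        congr 1
        refine setLIntegral_congr_fun measurableSet_Ioi fun θ (hθ : 0 < θ) => ?_
        rw [Real.mul_rpow hσ.le hθ.le, ENNReal.ofReal_mul (by positivity)]
        ring

end Heat

/-! ### Moments of the Wright density -/

section Moments

variable {α γ : ℝ}

theorem sin_rpow_neg_le (hγ : 0 ≤ γ) {ψ : ℝ} (h0 : 0 < ψ) (h1 : ψ ≤ Real.pi / 2) :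
    Real.sin ψ ^ (-γ) ≤ (2 / Real.pi) ^ (-γ) * ψ ^ (-γ) := by
  rw [← Real.mul_rpow (by positivity) h0.le]
  exact Real.rpow_le_rpow_of_nonpos (by positivity) (Real.mul_le_sin h0.le h1) (by linarith)

theorem lintegral_sin_rpow_neg_lt_top (hγ0 : 0 ≤ γ) (hγ1 : γ < 1) :
    ∫⁻ φ in Ioo 0 Real.pi, ENNReal.ofReal (Real.sin φ ^ (-γ)) < ∞ := by
  have hleft : IntervalIntegrable (fun φ : ℝ => φ ^ (-γ)) volume 0 Real.pi :=
    intervalIntegral.intervalIntegrable_rpow' (by linarith)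
  have hright : IntervalIntegrable (fun φ : ℝ => (Real.pi - φ) ^ (-γ)) volume 0 Real.pi := by
    simpa using (hleft.comp_sub_left Real.pi).symm
  have hint := (hleft.add hright).const_mul ((2 / Real.pi) ^ (-γ))
  rw [intervalIntegrable_iff_integrableOn_Ioo_of_le Real.pi_pos.le] at hint
  refine lt_of_le_of_lt (setLIntegral_mono' measurableSet_Ioo fun φ hφ => ?_)
    hint.lintegral_lt_top
  refine ENNReal.ofReal_le_ofReal ?_
  have hφ0 : 0 < φ := hφ.1
  have hφ1 : 0 < Real.pi - φ := by linarith [hφ.2]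
  rcases le_total φ (Real.pi / 2) with h | h
  · refine (sin_rpow_neg_le hγ0 hφ0 h).trans ?_
    gcongr
    exact le_add_of_nonneg_right (by positivity)
  · rw [← Real.sin_pi_sub]
    refine (sin_rpow_neg_le hγ0 hφ1 (by linarith)).trans ?_
    gcongr
    exact le_add_of_nonneg_left (by positivity)

theorem zolotarevKernel_rpow_le {φ : ℝ} (h0 : 0 < α) (h1 : α < 1) (hγ : 0 ≤ γ)
    (hφ : φ ∈ Ioo 0 Real.pi) :
    zolotarevKernel α φ ^ ((1 - α) * γ) ≤ Real.sin φ ^ (-γ) := by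
  have hβ : 0 < 1 - α := by linarith
  have hsin : 0 < Real.sin φ := Real.sin_pos_of_pos_of_lt_pi hφ.1 hφ.2
  have hsinα : 0 < Real.sin (α * φ) :=
    Real.sin_pos_of_pos_of_lt_pi (mul_pos h0 hφ.1) (by nlinarith [hφ.2, hφ.1])
  have : 0 < Real.sin ((1 - α) * φ) :=
    Real.sin_pos_of_pos_of_lt_pi (mul_pos hβ hφ.1) (by nlinarith [hφ.2, hφ.1])
  have hle : zolotarevKernel α φ ≤ Real.sin φ ^ (-(1 / (1 - α))) := by
    unfold zolotarevKernel
    rw [Real.rpow_neg hsin.le, ← one_div]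
    gcongr
    exact mul_le_one₀ (Real.sin_le_one _) (by positivity)
      (Real.rpow_le_one hsinα.le (Real.sin_le_one _) (by positivity))
  calc zolotarevKernel α φ ^ ((1 - α) * γ)
      ≤ (Real.sin φ ^ (-(1 / (1 - α)))) ^ ((1 - α) * γ) :=
        Real.rpow_le_rpow (zolotarevKernel_pos h0 h1 hφ).le hle (by positivity)
    _ = Real.sin φ ^ (-γ) := by
        rw [← Real.rpow_mul hsin.le]; congr 1; field_simp

theorem ofReal_wrightDensity_mul_rpow_eq (h0 : 0 < α) (h1 : α < 1) {θ : ℝ} (hθ : 0 < θ) :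
    ENNReal.ofReal (wrightDensity α θ * θ ^ γ) =
      ∫⁻ φ in Ioo 0 Real.pi, ENNReal.ofReal (θ ^ (γ + α / (1 - α)) *
        Real.exp (-zolotarevKernel α φ * θ ^ (1 / (1 - α))) *
          (zolotarevKernel α φ / (Real.pi * (1 - α)))) := by
  have : 0 < 1 - α := by linarith
  have hint := integrable_zolotarevKernel h0 h1 (c := θ ^ (1 / (1 - α))) (by positivity)
  have hfactor : ∀ φ, θ ^ (γ + α / (1 - α)) *
      Real.exp (-zolotarevKernel α φ * θ ^ (1 / (1 - α))) *
        (zolotarevKernel α φ / (Real.pi * (1 - α))) =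
      (θ ^ γ * (θ ^ (α / (1 - α)) / (Real.pi * (1 - α)))) *
        (zolotarevKernel α φ * Real.exp (-zolotarevKernel α φ * θ ^ (1 / (1 - α)))) := by
    intro φ
    rw [Real.rpow_add hθ]; ring
  simp only [hfactor]
  rw [← ofReal_integral_eq_lintegral_ofReal (hint.const_mul _), integral_const_mul]
  · congr 1; unfold wrightDensity; ring
  · filter_upwards [ae_restrict_mem measurableSet_Ioo] with φ hφ
    have := zolotarevKernel_pos h0 h1 hφ
    simp only [Pi.zero_apply]; positivity

theorem lintegral_rpow_mul_exp_neg_mul_rpow_eq (h1 : α < 1) (hγ : (1 - α) * γ < 1)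
    {κ : ℝ} (hκ : 0 < κ) :
    ∫⁻ θ in Ioi (0 : ℝ), ENNReal.ofReal (θ ^ (-γ + α / (1 - α)) *
        Real.exp (-κ * θ ^ (1 / (1 - α))) * (κ / (Real.pi * (1 - α)))) =
      ENNReal.ofReal (Real.Gamma (1 - (1 - α) * γ) * κ ^ ((1 - α) * γ) / Real.pi) := by
  have hβ : 0 < 1 - α := by linarith
  have hΓ : 0 < Real.Gamma (1 - (1 - α) * γ) := Real.Gamma_pos_of_pos (by linarith)
  have hexp : (-γ + α / (1 - α) + 1) / (1 / (1 - α)) = 1 - (1 - α) * γ := by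
    field_simp; ring
  have hexp_neg : -(-γ + α / (1 - α) + 1) / (1 / (1 - α)) = -1 + (1 - α) * γ := by
    rw [neg_div, hexp]; ring
  have hr : -1 < -γ + α / (1 - α) := by
    have : γ < 1 / (1 - α) := by rw [lt_div_iff₀ hβ]; linarith
    have : 1 / (1 - α) = 1 + α / (1 - α) := by field_simp; ring
    linarith
  have hI := integral_rpow_mul_exp_neg_mul_rpow (p := 1 / (1 - α)) (by positivity) hr hκ
  rw [hexp, hexp_neg] at hI
  have hint := Integrable.of_integral_ne_zero (hI ▸ (by positivity :
    κ ^ (-1 + (1 - α) * γ) * (1 / (1 / (1 - α))) * Real.Gamma (1 - (1 - α) * γ) ≠ 0))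
  rw [← ofReal_integral_eq_lintegral_ofReal (hint.mul_const _), integral_mul_const, hI]
  · rw [Real.rpow_add hκ, Real.rpow_neg_one]
    congr 1
    field_simp
  · filter_upwards [ae_restrict_mem measurableSet_Ioi] with θ (hθ : 0 < θ)
    simp only [Pi.zero_apply]; positivity

theorem negMoment_weightP_le (h0 : 0 < α) (h1 : α < 1) (hγ0 : 0 ≤ γ) (hγ : (1 - α) * γ < 1) :
    negMoment (weightP α) γ ≤ ENNReal.ofReal (Real.Gamma (1 - (1 - α) * γ)) *
      ∫⁻ φ in Ioo 0 Real.pi, ENNReal.ofReal (Real.sin φ ^ (-γ)) := by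
  have hΓ : 0 < Real.Gamma (1 - (1 - α) * γ) := Real.Gamma_pos_of_pos (by linarith)
  have hK := measurable_zolotarevKernel α
  calc negMoment (weightP α) γ
      = ∫⁻ θ in Ioi (0 : ℝ), ∫⁻ φ in Ioo 0 Real.pi, ENNReal.ofReal (θ ^ (-γ + α / (1 - α)) *
          Real.exp (-zolotarevKernel α φ * θ ^ (1 / (1 - α))) *
            (zolotarevKernel α φ / (Real.pi * (1 - α)))) := by
        refine setLIntegral_congr_fun measurableSet_Ioi fun θ hθ => ?_
        rw [← ofReal_wrightDensity_mul_rpow_eq h0 h1 hθ,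
          ENNReal.ofReal_mul (wrightDensity_pos h0 h1 hθ).le, weightP]
    _ = ∫⁻ φ in Ioo 0 Real.pi, ENNReal.ofReal
          (Real.Gamma (1 - (1 - α) * γ) * zolotarevKernel α φ ^ ((1 - α) * γ) / Real.pi) := by
        rw [lintegral_lintegral_swap (by unfold Function.uncurry; fun_prop)]
        exact setLIntegral_congr_fun measurableSet_Ioo fun φ hφ =>
          lintegral_rpow_mul_exp_neg_mul_rpow_eq h1 hγ (zolotarevKernel_pos h0 h1 hφ)
    _ ≤ ∫⁻ φ in Ioo 0 Real.pi, ENNReal.ofReal (Real.Gamma (1 - (1 - α) * γ)) *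
          ENNReal.ofReal (Real.sin φ ^ (-γ)) := by
        refine setLIntegral_mono' measurableSet_Ioo fun φ hφ => ?_
        have hκ := zolotarevKernel_pos h0 h1 hφ
        rw [← ENNReal.ofReal_mul hΓ.le]
        refine ENNReal.ofReal_le_ofReal ?_
        calc _ ≤ Real.Gamma (1 - (1 - α) * γ) * zolotarevKernel α φ ^ ((1 - α) * γ) :=
              div_le_self (by positivity) (by linarith [Real.pi_gt_three])
          _ ≤ _ := by gcongr; exact zolotarevKernel_rpow_le h0 h1 hγ0 hφ
    _ = _ := lintegral_const_mul _ (by fun_prop)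

/-- The moment `∫₀^∞ θⁿ h_α(θ) dθ = n! / Γ(1 + nα)` of the Wright density. -/
noncomputable def wrightMoment (α : ℝ) (n : ℕ) : ℝ :=
  Real.Gamma (n + 1) * (Real.Gamma (1 + α * n))⁻¹

theorem wrightMoment_pos (h0 : 0 < α) (n : ℕ) : 0 < wrightMoment α n :=
  mul_pos (Real.Gamma_pos_of_pos (by positivity))
    (inv_pos.mpr (Real.Gamma_pos_of_pos (by positivity)))

theorem integrableOn_wrightDensity_mul_pow (h0 : 0 < α) (h1 : α < 1) (n : ℕ) :
    IntegrableOn (fun θ => wrightDensity α θ * θ ^ n) (Ioi 0) := by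
  have hmeas := measurable_wrightDensity α
  refine ⟨Measurable.aestronglyMeasurable (by fun_prop), ?_⟩
  rw [hasFiniteIntegral_iff_ofReal, lintegral_wrightDensity_pow h0 h1 n]
  · exact ENNReal.ofReal_lt_top
  · filter_upwards [ae_restrict_mem measurableSet_Ioi] with θ (hθ : 0 < θ)
    exact mul_nonneg (wrightDensity_pos h0 h1 hθ).le (by positivity)

theorem integral_wrightDensity_mul_pow (h0 : 0 < α) (h1 : α < 1) (n : ℕ) :
    ∫ θ in Ioi (0 : ℝ), wrightDensity α θ * θ ^ n = wrightMoment α n := by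
  have hnonneg : 0 ≤ᵐ[volume.restrict (Ioi (0 : ℝ))] fun θ => wrightDensity α θ * θ ^ n := by
    filter_upwards [ae_restrict_mem measurableSet_Ioi] with θ (hθ : 0 < θ)
    exact mul_nonneg (wrightDensity_pos h0 h1 hθ).le (by positivity)
  rw [integral_eq_lintegral_of_nonneg_ae hnonneg
    (integrableOn_wrightDensity_mul_pow h0 h1 n).aestronglyMeasurable,
    lintegral_wrightDensity_pow h0 h1 n]
  exact ENNReal.toReal_ofReal (wrightMoment_pos h0 n).le

theorem lintegral_weightP (h0 : 0 < α) (h1 : α < 1) : ∫⁻ θ in Ioi (0 : ℝ), weightP α θ = 1 := by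
  simpa [weightP] using lintegral_wrightDensity_pow h0 h1 0

theorem lintegral_weightS (h0 : 0 < α) (h1 : α < 1) :
    ∫⁻ θ in Ioi (0 : ℝ), weightS α θ = ENNReal.ofReal (wrightMoment α 1) := by
  simpa only [weightS, wrightMoment, pow_one, mul_comm] using lintegral_wrightDensity_pow h0 h1 1

theorem negMoment_weightS_le (h0 : 0 < α) (h1 : α < 1) (hγ0 : 0 ≤ γ) (hγ1 : γ ≤ 1) :
    negMoment (weightS α) γ ≤ 1 + ENNReal.ofReal (wrightMoment α 1) := by
  have hpow : ∀ θ : ℝ, 0 < θ → θ * θ ^ (-γ) ≤ 1 + θ := by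
    intro θ hθ
    rw [mul_comm, ← Real.rpow_add_one hθ.ne']
    rcases le_total θ 1 with h | h
    · linarith [Real.rpow_le_one hθ.le h (by linarith : 0 ≤ -γ + 1)]
    · have := Real.rpow_le_rpow_of_exponent_le h (by linarith : -γ + 1 ≤ 1)
      rw [Real.rpow_one] at this; linarith
  calc negMoment (weightS α) γ
      ≤ ∫⁻ θ in Ioi (0 : ℝ), (weightP α θ + weightS α θ) := by
        refine setLIntegral_mono' measurableSet_Ioi fun θ hθ => ?_
        have hw := wrightDensity_pos h0 h1 hθ
        replace hθ : 0 < θ := hθ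
        rw [weightP, weightS, ← ENNReal.ofReal_mul (by positivity),
          ← ENNReal.ofReal_add (by positivity) (by positivity)]
        refine ENNReal.ofReal_le_ofReal ?_
        linarith [mul_le_mul_of_nonneg_left (hpow θ hθ) hw.le]
    _ = 1 + ENNReal.ofReal (wrightMoment α 1) := by
        rw [lintegral_add_left (by fun_prop), lintegral_weightP h0 h1, lintegral_weightS h0 h1]

theorem eventually_mem_Ioo_zero_one : ∀ᶠ α : ℝ in 𝓝[<] 1, α ∈ Ioo (0 : ℝ) 1 :=
  Ioo_mem_nhdsLT one_pos

theorem tendsto_Gamma_comp {g : ℝ → ℝ} {a : ℝ} (hg : ContinuousAt g a) (ha : 0 < g a)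
    (s : Set ℝ) : Tendsto (fun x => Real.Gamma (g x)) (𝓝[s] a) (𝓝 (Real.Gamma (g a))) := by
  have hΓ : ContinuousAt Real.Gamma (g a) :=
    (Real.differentiableAt_Gamma fun m hm => by
      linarith [(Nat.cast_nonneg m : (0 : ℝ) ≤ m)]).continuousAt
  exact (hΓ.comp hg).tendsto.mono_left nhdsWithin_le_nhds

theorem tendsto_wrightMoment (n : ℕ) :
    Tendsto (fun α : ℝ => wrightMoment α n) (𝓝[<] 1) (𝓝 1) := by
  have hpos : 0 < Real.Gamma (1 + 1 * n) := Real.Gamma_pos_of_pos (by positivity)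
  have hlim := ((tendsto_Gamma_comp (g := fun α : ℝ => 1 + α * n) (a := 1) (by fun_prop)
    (by positivity) (Iio 1)).inv₀ hpos.ne').const_mul (Real.Gamma (n + 1))
  have hone : Real.Gamma ((n : ℝ) + 1) * (Real.Gamma (1 + 1 * n))⁻¹ = 1 := by
    rw [one_mul, add_comm (1 : ℝ)] at *
    exact mul_inv_cancel₀ hpos.ne'
  rwa [hone] at hlim

theorem exists_negMoment_weightP_le (hγ0 : 0 ≤ γ) (hγ1 : γ < 1) :
    ∃ C : ℝ, ∀ᶠ α : ℝ in 𝓝[<] 1, negMoment (weightP α) γ ≤ ENNReal.ofReal C := by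
  set I := ∫⁻ φ in Ioo 0 Real.pi, ENNReal.ofReal (Real.sin φ ^ (-γ))
  have hI : I ≠ ∞ := (lintegral_sin_rpow_neg_lt_top hγ0 hγ1).ne
  have hΓ := tendsto_Gamma_comp (g := fun α : ℝ => 1 - (1 - α) * γ) (a := 1) (by fun_prop)
    (by norm_num) (Iio 1)
  simp only [sub_self, zero_mul, sub_zero, Real.Gamma_one] at hΓ
  refine ⟨2 * I.toReal, ?_⟩
  filter_upwards [eventually_mem_Ioo_zero_one, hΓ.eventually_le_const one_lt_two] with α hα hΓα
  calc negMoment (weightP α) γ ≤ ENNReal.ofReal (Real.Gamma (1 - (1 - α) * γ)) * I :=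
        negMoment_weightP_le hα.1 hα.2 hγ0 (by nlinarith [hα.1, hα.2])
    _ ≤ ENNReal.ofReal 2 * I := by gcongr
    _ = ENNReal.ofReal (2 * I.toReal) := by
        rw [ENNReal.ofReal_mul zero_le_two, ENNReal.ofReal_toReal hI]

theorem eventually_negMoment_weightS_le (hγ0 : 0 ≤ γ) (hγ1 : γ ≤ 1) :
    ∀ᶠ α : ℝ in 𝓝[<] 1, negMoment (weightS α) γ ≤ ENNReal.ofReal 3 := by
  filter_upwards [eventually_mem_Ioo_zero_one,
    (tendsto_wrightMoment 1).eventually_le_const one_lt_two] with α hα hm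
  calc negMoment (weightS α) γ ≤ 1 + ENNReal.ofReal (wrightMoment α 1) :=
        negMoment_weightS_le hα.1 hα.2 hγ0 hγ1
    _ ≤ ENNReal.ofReal 1 + ENNReal.ofReal 2 := by rw [ENNReal.ofReal_one]; gcongr
    _ = ENNReal.ofReal 3 := by rw [← ENNReal.ofReal_add] <;> norm_num

/-- The weight `w` has a definite part of its mass at distance at most `1 / 2` from `1`. For
`weightP α` and `weightS α` this holds as `α → 1`, where `h_α` tends to the Dirac mass at `1`. -/
def ConcentratesNearOne (w : ℝ → ℝ≥0∞) : Prop :=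
  ENNReal.ofReal (1 / 4) ≤ ∫⁻ θ in Icc (1 / 2 : ℝ) (3 / 2), w θ

theorem lintegral_sq_sub_one_mul_wrightDensity (h0 : 0 < α) (h1 : α < 1) :
    ∫⁻ θ in Ioi (0 : ℝ), ENNReal.ofReal ((θ - 1) ^ 2 * wrightDensity α θ) =
      ENNReal.ofReal (wrightMoment α 2 - 2 * wrightMoment α 1 + wrightMoment α 0) := by
  have hint := integrableOn_wrightDensity_mul_pow h0 h1
  have hexpand : ∀ θ, (θ - 1) ^ 2 * wrightDensity α θ = wrightDensity α θ * θ ^ 2 -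
      2 * (wrightDensity α θ * θ ^ 1) + wrightDensity α θ * θ ^ 0 := fun θ => by ring
  rw [← ofReal_integral_eq_lintegral_ofReal]
  · simp only [hexpand, ← integral_wrightDensity_mul_pow h0 h1]
    rw [integral_add (by exact (hint 2).sub ((hint 1).const_mul 2)) (hint 0),
      integral_sub (hint 2) ((hint 1).const_mul 2), integral_const_mul]
  · simp only [hexpand]
    exact ((hint 2).sub ((hint 1).const_mul 2)).add (hint 0)
  · filter_upwards [ae_restrict_mem measurableSet_Ioi] with θ hθ
    exact mul_nonneg (sq_nonneg _) (wrightDensity_pos h0 h1 hθ).le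

theorem one_le_lintegral_weightP_add (h0 : 0 < α) (h1 : α < 1) :
    1 ≤ (∫⁻ θ in Icc (1 / 2 : ℝ) (3 / 2), weightP α θ) + ENNReal.ofReal
      (4 * (wrightMoment α 2 - 2 * wrightMoment α 1 + wrightMoment α 0)) := by
  have hsub : Icc (1 / 2 : ℝ) (3 / 2) ⊆ Ioi 0 := fun θ hθ => mem_Ioi.mpr (by linarith [hθ.1])
  have hchebyshev : ∀ θ ∈ Ioi (0 : ℝ), weightP α θ ≤
      (Icc (1 / 2 : ℝ) (3 / 2)).indicator (weightP α) θ +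
        ENNReal.ofReal 4 * ENNReal.ofReal ((θ - 1) ^ 2 * wrightDensity α θ) := by
    intro θ hθ
    by_cases hmem : θ ∈ Icc (1 / 2 : ℝ) (3 / 2)
    · rw [indicator_of_mem hmem]
      exact le_self_add
    · have hw := wrightDensity_pos h0 h1 hθ
      have hfar : 1 ≤ 4 * (θ - 1) ^ 2 := by
        rw [mem_Icc, not_and_or, not_le, not_le] at hmem
        rcases hmem with h | h <;> nlinarith
      rw [indicator_of_notMem hmem, zero_add, ← ENNReal.ofReal_mul (by norm_num)]
      exact ENNReal.ofReal_le_ofReal (by nlinarith)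
  rw [← lintegral_weightP h0 h1, ENNReal.ofReal_mul (by norm_num),
    ← lintegral_sq_sub_one_mul_wrightDensity h0 h1]
  refine (setLIntegral_mono' measurableSet_Ioi hchebyshev).trans_eq ?_
  have hmeas := measurable_wrightDensity α
  rw [lintegral_add_left ((measurable_weightP α).indicator measurableSet_Icc),
    setLIntegral_indicator measurableSet_Icc, inter_eq_left.mpr hsub,
    lintegral_const_mul _ (by fun_prop)]

theorem eventually_half_le_lintegral_weightP : ∀ᶠ α : ℝ in 𝓝[<] 1,
    ENNReal.ofReal (1 / 2) ≤ ∫⁻ θ in Icc (1 / 2 : ℝ) (3 / 2), weightP α θ := by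
  have hvar : Tendsto (fun α => 4 * (wrightMoment α 2 - 2 * wrightMoment α 1 + wrightMoment α 0))
      (𝓝[<] 1) (𝓝 0) := by
    convert (((tendsto_wrightMoment 2).sub ((tendsto_wrightMoment 1).const_mul 2)).add
      (tendsto_wrightMoment 0)).const_mul 4 using 2
    norm_num
  filter_upwards [eventually_mem_Ioo_zero_one, hvar.eventually_le_const one_half_pos]
    with α hα hsmall
  refine ENNReal.le_of_add_le_add_right (ENNReal.ofReal_ne_top (r := 1 / 2)) ?_
  calc ENNReal.ofReal (1 / 2) + ENNReal.ofReal (1 / 2) = 1 := by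
        rw [← ENNReal.ofReal_add (by norm_num) (by norm_num)]; norm_num
    _ ≤ _ := one_le_lintegral_weightP_add hα.1 hα.2
    _ ≤ _ := by gcongr

theorem eventually_concentratesNearOne_weightP :
    ∀ᶠ α : ℝ in 𝓝[<] 1, ConcentratesNearOne (weightP α) :=
  eventually_half_le_lintegral_weightP.mono fun _ h =>
    (ENNReal.ofReal_le_ofReal (by norm_num)).trans h

theorem eventually_concentratesNearOne_weightS :
    ∀ᶠ α : ℝ in 𝓝[<] 1, ConcentratesNearOne (weightS α) := by
  filter_upwards [eventually_half_le_lintegral_weightP] with α hhalf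
  calc ENNReal.ofReal (1 / 4) = ENNReal.ofReal (1 / 2) * ENNReal.ofReal (1 / 2) := by
        rw [← ENNReal.ofReal_mul (by norm_num)]; norm_num
    _ ≤ ENNReal.ofReal (1 / 2) * ∫⁻ θ in Icc (1 / 2 : ℝ) (3 / 2), weightP α θ := by gcongr
    _ = ∫⁻ θ in Icc (1 / 2 : ℝ) (3 / 2), ENNReal.ofReal (1 / 2) * weightP α θ :=
        (lintegral_const_mul _ (measurable_weightP α)).symm
    _ ≤ ∫⁻ θ in Icc (1 / 2 : ℝ) (3 / 2), weightS α θ := by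
        refine setLIntegral_mono' measurableSet_Icc fun θ hθ => ?_
        rw [weightS, ENNReal.ofReal_mul (by linarith [hθ.1]), weightP]
        gcongr
        exact hθ.1

end Moments

/-! ### Beta integrals -/

section Beta

variable {a b c t : ℝ}

theorem setLIntegral_Ioo_le_add (f : ℝ → ℝ≥0∞) (a b c : ℝ) :
    ∫⁻ s in Ioo a c, f s ≤ (∫⁻ s in Ioo a b, f s) + ∫⁻ s in Ioo b c, f s := by
  have hsub : Ioo a c ⊆ Ioo a b ∪ ({b} ∪ Ioo b c) := by
    intro s hs
    rcases lt_trichotomy s b with h | h | h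
    · exact Or.inl ⟨hs.1, h⟩
    · exact Or.inr (Or.inl h)
    · exact Or.inr (Or.inr ⟨h, hs.2⟩)
  calc ∫⁻ s in Ioo a c, f s ≤ ∫⁻ s in Ioo a b ∪ ({b} ∪ Ioo b c), f s := lintegral_mono_set hsub
    _ ≤ (∫⁻ s in Ioo a b, f s) + ((∫⁻ s in {b}, f s) + ∫⁻ s in Ioo b c, f s) :=
        (lintegral_union_le _ _ _).trans (by gcongr; exact lintegral_union_le _ _ _)
    _ = (∫⁻ s in Ioo a b, f s) + ∫⁻ s in Ioo b c, f s := by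
        rw [setLIntegral_measure_zero _ _ (measure_singleton b), zero_add]

theorem setLIntegral_Ioo_comp_sub_left (f : ℝ → ℝ≥0∞) (t a b : ℝ) :
    ∫⁻ s in Ioo a b, f (t - s) = ∫⁻ s in Ioo (t - b) (t - a), f s := by
  rw [← lintegral_indicator measurableSet_Ioo, ← lintegral_indicator measurableSet_Ioo,
    ← lintegral_sub_left_eq_self ((Ioo (t - b) (t - a)).indicator f) t]
  refine lintegral_congr fun s => ?_
  simp only [indicator, mem_Ioo, sub_lt_sub_iff_left]
  simp only [and_comm]

theorem setLIntegral_Ioo_rpow (hb : 0 < b) (hc : 0 ≤ c) :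
    ∫⁻ s in Ioo 0 c, ENNReal.ofReal (s ^ (b - 1)) = ENNReal.ofReal (c ^ b / b) := by
  have hint : IntervalIntegrable (fun s : ℝ => s ^ (b - 1)) volume 0 c :=
    intervalIntegral.intervalIntegrable_rpow' (by linarith)
  have hval := integral_rpow (a := 0) (b := c) (Or.inl (by linarith : -1 < b - 1))
  rw [intervalIntegral.integral_of_le hc, integral_Ioc_eq_integral_Ioo, sub_add_cancel,
    Real.zero_rpow hb.ne', sub_zero] at hval
  rw [intervalIntegrable_iff_integrableOn_Ioo_of_le hc] at hint
  rw [← hval, ofReal_integral_eq_lintegral_ofReal hint]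
  filter_upwards [ae_restrict_mem measurableSet_Ioo] with s hs
  exact Real.rpow_nonneg hs.1.le _

theorem setLIntegral_Ioo_sub_rpow (ha : 0 < a) (hc : c ≤ t) :
    ∫⁻ s in Ioo c t, ENNReal.ofReal ((t - s) ^ (a - 1)) = ENNReal.ofReal ((t - c) ^ a / a) := by
  rw [setLIntegral_Ioo_comp_sub_left (fun s => ENNReal.ofReal (s ^ (a - 1))), sub_self,
    setLIntegral_Ioo_rpow ha (sub_nonneg.mpr hc)]

theorem setLIntegral_beta_half_le (ha : a ≤ 1) (hb : 0 < b) (ht : 0 < t) :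
    ∫⁻ s in Ioo 0 (t / 2), ENNReal.ofReal ((t - s) ^ (a - 1)) * ENNReal.ofReal (s ^ (b - 1)) ≤
      ENNReal.ofReal ((t / 2) ^ (a + b - 1) / b) := by
  calc ∫⁻ s in Ioo 0 (t / 2), ENNReal.ofReal ((t - s) ^ (a - 1)) * ENNReal.ofReal (s ^ (b - 1))
      ≤ ∫⁻ s in Ioo 0 (t / 2), ENNReal.ofReal ((t / 2) ^ (a - 1)) *
          ENNReal.ofReal (s ^ (b - 1)) := by
        refine setLIntegral_mono' measurableSet_Ioo fun s hs => ?_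
        gcongr ENNReal.ofReal ?_ * _
        exact Real.rpow_le_rpow_of_nonpos (by positivity) (by linarith [hs.2]) (by linarith)
    _ = ENNReal.ofReal ((t / 2) ^ (a - 1) * ((t / 2) ^ b / b)) := by
        rw [lintegral_const_mul _ (by fun_prop), setLIntegral_Ioo_rpow hb (by positivity),
          ENNReal.ofReal_mul (by positivity)]
    _ = ENNReal.ofReal ((t / 2) ^ (a + b - 1) / b) := by
        rw [← mul_div_assoc, ← Real.rpow_add (by positivity), sub_add_eq_add_sub]

theorem setLIntegral_beta_le (ha : 0 < a) (ha1 : a ≤ 1) (hb : 0 < b) (hb1 : b ≤ 1) (ht : 0 < t) :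
    ∫⁻ s in Ioo 0 t, ENNReal.ofReal ((t - s) ^ (a - 1)) * ENNReal.ofReal (s ^ (b - 1)) ≤
      ENNReal.ofReal (2 * (1 / a + 1 / b) * t ^ (a + b - 1)) := by
  set f : ℝ → ℝ≥0∞ := fun s => ENNReal.ofReal ((t - s) ^ (a - 1)) * ENNReal.ofReal (s ^ (b - 1))
  have hreflect : ∫⁻ s in Ioo (t / 2) t, f s = ∫⁻ s in Ioo 0 (t / 2),
      ENNReal.ofReal ((t - s) ^ (b - 1)) * ENNReal.ofReal (s ^ (a - 1)) := by
    have hf : ∀ s, f s = ENNReal.ofReal ((t - (t - s)) ^ (b - 1)) *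
        ENNReal.ofReal ((t - s) ^ (a - 1)) := fun s => by
      rw [sub_sub_cancel, mul_comm]
    simp only [hf]
    rw [setLIntegral_Ioo_comp_sub_left
      (fun s => ENNReal.ofReal ((t - s) ^ (b - 1)) * ENNReal.ofReal (s ^ (a - 1))), sub_self,
      sub_half]
  have hpow : (t / 2) ^ (a + b - 1) ≤ 2 * t ^ (a + b - 1) := by
    rw [Real.div_rpow ht.le zero_le_two, div_eq_mul_inv, ← Real.rpow_neg zero_le_two, mul_comm]
    gcongr
    calc (2 : ℝ) ^ (-(a + b - 1)) ≤ 2 ^ (1 : ℝ) :=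
          Real.rpow_le_rpow_of_exponent_le one_le_two (by linarith)
      _ = 2 := Real.rpow_one _
  calc ∫⁻ s in Ioo 0 t, f s
      ≤ (∫⁻ s in Ioo 0 (t / 2), f s) + ∫⁻ s in Ioo (t / 2) t, f s := setLIntegral_Ioo_le_add ..
    _ ≤ ENNReal.ofReal ((t / 2) ^ (a + b - 1) / b) +
          ENNReal.ofReal ((t / 2) ^ (a + b - 1) / a) := by
        rw [hreflect]
        gcongr
        · exact setLIntegral_beta_half_le ha1 hb ht
        · rw [add_comm a b]
          exact setLIntegral_beta_half_le hb1 ha ht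
    _ = ENNReal.ofReal ((t / 2) ^ (a + b - 1) * (1 / a + 1 / b)) := by
        rw [← ENNReal.ofReal_add (by positivity) (by positivity)]
        congr 1
        ring
    _ ≤ ENNReal.ofReal (2 * (1 / a + 1 / b) * t ^ (a + b - 1)) := by
        refine ENNReal.ofReal_le_ofReal ?_
        calc _ ≤ 2 * t ^ (a + b - 1) * (1 / a + 1 / b) := by gcongr
          _ = _ := by ring

end Beta

/-! ### The integral equation -/

section MildMap

variable {N : ℕ} {α p : ℝ} {μ : Measure (Space N)} {u : ℝ → Space N → ℝ≥0∞}

/-- The kernel `τ^{α-1} ∫₀^∞ θ h_α(θ) G(τ^α θ, z) dθ` of the Duhamel term, up to the factor `α`. -/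
noncomputable def duhamelKernel (α τ : ℝ) (z : Space N) : ℝ≥0∞ :=
  ENNReal.ofReal (τ ^ (α - 1)) * subordKernel (weightS α) (τ ^ α) z

/-- The Duhamel term of the integral equation, up to the factor `α`, as an integral over the
space-time cylinder `(0, t) × ℝᴺ`. -/
noncomputable def duhamel (α p : ℝ) (u : ℝ → Space N → ℝ≥0∞) (t : ℝ) (x : Space N) : ℝ≥0∞ :=
  ∫⁻ z in Ioo 0 t ×ˢ univ, u z.1 z.2 ^ p * duhamelKernel α (t - z.1) (x - z.2)

/-- The right-hand side of the integral equation. -/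
noncomputable def mildMap (α p : ℝ) (μ : Measure (Space N)) (u : ℝ → Space N → ℝ≥0∞) (t : ℝ)
    (x : Space N) : ℝ≥0∞ :=
  opP α t μ x + ENNReal.ofReal α * duhamel α p u t x

@[fun_prop]
theorem measurable_duhamelKernel (α : ℝ) :
    Measurable fun z : ℝ × Space N => duhamelKernel α z.1 z.2 := by
  unfold duhamelKernel; fun_prop

theorem measurable_duhamel (hu : Measurable fun z : ℝ × Space N => u z.1 z.2) :
    Measurable fun z : ℝ × Space N => duhamel α p u z.1 z.2 := by
  have hset : MeasurableSet
      {a : (ℝ × Space N) × (ℝ × Space N) | a.2 ∈ Ioo 0 a.1.1 ×ˢ (univ : Set (Space N))} := by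
    simp only [mem_prod, mem_Ioo, mem_univ, and_true]
    measurability
  have hint : Measurable fun a : (ℝ × Space N) × (ℝ × Space N) =>
      u a.2.1 a.2.2 ^ p * duhamelKernel α (a.1.1 - a.2.1) (a.1.2 - a.2.2) := by
    fun_prop
  unfold duhamel
  simp only [← lintegral_indicator (measurableSet_Ioo.prod MeasurableSet.univ)]
  exact (hint.indicator hset).lintegral_prod_right'

theorem measurable_opP [SFinite μ] : Measurable fun z : ℝ × Space N => opP α z.1 μ z.2 := by
  simp only [opP_eq_lintegral]
  exact Measurable.lintegral_prod_right' (f := fun a : (ℝ × Space N) × Space N =>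
    subordKernel (weightP α) (a.1.1 ^ α) (a.1.2 - a.2)) (by fun_prop)

theorem measurable_mildMap [SFinite μ] (hu : Measurable fun z : ℝ × Space N => u z.1 z.2) :
    Measurable fun z : ℝ × Space N => mildMap α p μ u z.1 z.2 :=
  measurable_opP.add ((measurable_duhamel hu).const_mul _)

theorem rpow_mul_opS_withDensity {τ : ℝ} {f : Space N → ℝ≥0∞} (hf : Measurable f) (x : Space N) :
    ENNReal.ofReal (τ ^ (α - 1)) * opS α τ (volume.withDensity f) x
      = ∫⁻ y, f y * duhamelKernel α τ (x - y) := by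
  have hker : Measurable fun y : Space N => subordKernel (weightS α) (τ ^ α) (x - y) := by
    fun_prop
  rw [opS_eq_lintegral, lintegral_withDensity_eq_lintegral_mul _ hf hker,
    ← lintegral_const_mul _ (hf.mul hker)]
  refine lintegral_congr fun y => ?_
  rw [duhamelKernel, Pi.mul_apply, mul_left_comm]

theorem duhamel_eq_lintegral_opS (hu : Measurable fun z : ℝ × Space N => u z.1 z.2) (t : ℝ)
    (x : Space N) :
    duhamel α p u t x = ∫⁻ s in Ioo 0 t, ENNReal.ofReal ((t - s) ^ (α - 1)) *
      opS α (t - s) (volume.withDensity fun y => u s y ^ p) x := by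
  have hint : Measurable fun z : ℝ × Space N =>
      u z.1 z.2 ^ p * duhamelKernel α (t - z.1) (x - z.2) := by
    fun_prop
  rw [duhamel, Measure.volume_eq_prod, setLIntegral_prod _ hint.aemeasurable]
  refine lintegral_congr fun s => ?_
  have hus : Measurable fun y => u s y ^ p := (hu.comp measurable_prodMk_left).pow_const p
  rw [setLIntegral_univ, rpow_mul_opS_withDensity hus]

theorem isSolution_iff {T : ℝ} :
    IsSolution α p T μ u ↔ (Measurable fun z : ℝ × Space N => u z.1 z.2) ∧
      ∀ᵐ t : ℝ, t ∈ Ioc 0 T → ∀ᵐ x : Space N, u t x < ∞ ∧ u t x = mildMap α p μ u t x := by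
  refine and_congr_right fun hu => ?_
  simp only [mildMap, duhamel_eq_lintegral_opS hu]

theorem monotone_mildMap (hp : 0 ≤ p) : Monotone (mildMap (N := N) α p μ) := by
  intro u v huv t x
  unfold mildMap duhamel
  gcongr with z
  exact huv _ _

theorem mildMap_iSup (hp : 0 < p) {u : ℕ → ℝ → Space N → ℝ≥0∞}
    (hu : ∀ n, Measurable fun z : ℝ × Space N => u n z.1 z.2) (hmono : Monotone u) :
    mildMap α p μ (⨆ n, u n) = ⨆ n, mildMap α p μ (u n) := by
  ext t x
  have hmeas : ∀ n, Measurable fun z : ℝ × Space N =>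
      u n z.1 z.2 ^ p * duhamelKernel α (t - z.1) (x - z.2) := by
    intro n
    have := hu n
    fun_prop
  have hmono' : Monotone fun n (z : ℝ × Space N) =>
      u n z.1 z.2 ^ p * duhamelKernel α (t - z.1) (x - z.2) := by
    intro m n hmn z
    dsimp only
    gcongr
    exact hmono hmn _ _
  have hrpow : ∀ z : ℝ × Space N, (⨆ n, u n z.1 z.2) ^ p = ⨆ n, u n z.1 z.2 ^ p := fun z =>
    (ENNReal.orderIsoRpow p hp).map_iSup fun n => u n z.1 z.2
  simp only [mildMap, duhamel, iSup_apply, hrpow, ENNReal.iSup_mul]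
  rw [lintegral_iSup hmeas hmono', ENNReal.mul_iSup, ENNReal.add_iSup]

end MildMap

/-! ### Global existence by monotone iteration -/

section Existence

variable {N : ℕ} {α p : ℝ} {μ : Measure (Space N)} {u : ℝ → Space N → ℝ≥0∞}

/-- The decay estimate `‖u(t)‖_p ≤ B t^{-β}` for all `t > 0`. -/
def LpDecay (p β B : ℝ) (u : ℝ → Space N → ℝ≥0∞) : Prop :=
  ∀ t, 0 < t → ∫⁻ x, u t x ^ p ≤ ENNReal.ofReal (B * t ^ (-β)) ^ p

theorem LpDecay.mono (hp : 0 ≤ p) {β B : ℝ} {v : ℝ → Space N → ℝ≥0∞} (hv : LpDecay p β B v)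
    (huv : ∀ t x, u t x ≤ v t x) : LpDecay p β B u := fun t ht =>
  (lintegral_mono fun x => ENNReal.rpow_le_rpow (huv t x) hp).trans (hv t ht)

theorem LpDecay.add (hp : 1 ≤ p) {β A B : ℝ} {v : ℝ → Space N → ℝ≥0∞} (hA : 0 ≤ A) (hB : 0 ≤ B)
    (hum : Measurable fun z : ℝ × Space N => u z.1 z.2)
    (hvm : Measurable fun z : ℝ × Space N => v z.1 z.2)
    (hu : LpDecay p β A u) (hv : LpDecay p β B v) :
    LpDecay p β (A + B) fun t x => u t x + v t x := by
  have hp0 : 0 < p := by linarith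
  have hroot : ∀ {a b : ℝ≥0∞}, a ≤ b ^ p ↔ a ^ (1 / p) ≤ b := fun {a b} => by
    rw [one_div, ENNReal.rpow_inv_le_iff hp0]
  intro t ht
  rw [hroot, add_mul, ENNReal.ofReal_add (by positivity) (by positivity)]
  exact (ENNReal.lintegral_Lp_add_le (hum.comp measurable_prodMk_left).aemeasurable
    (hvm.comp measurable_prodMk_left).aemeasurable hp).trans
    (add_le_add (hroot.mp (hu t ht)) (hroot.mp (hv t ht)))

theorem lpDecay_opP [SFinite μ] (hp : 1 < p) {C m : ℝ} (hC : 0 < C)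
    (hP : negMoment (weightP α) (smoothingExponent N p) ≤ ENNReal.ofReal C)
    (hμ : μ univ ≤ ENNReal.ofReal m) :
    LpDecay p (α * smoothingExponent N p) (m * C) fun t x => opP α t μ x := by
  intro t ht
  set γ := smoothingExponent N p
  have hker : Measurable fun z : Space N × Space N =>
      subordKernel (weightP α) (t ^ α) (z.2 - z.1) := by
    fun_prop
  have hbound : ∀ y : Space N, ∫⁻ x, subordKernel (weightP α) (t ^ α) (x - y) ^ p
      ≤ ENNReal.ofReal (C * t ^ (-(α * γ))) ^ p := by
    intro y
    refine (lintegral_subordKernel_rpow_le hp (measurable_weightP α) (by positivity) y).trans ?_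
    rw [mul_comm C, ENNReal.ofReal_mul (by positivity), ← Real.rpow_mul ht.le, mul_neg]
    gcongr
  have hpos : ENNReal.ofReal (C * t ^ (-(α * γ))) ≠ 0 := by
    rw [ne_eq, ENNReal.ofReal_eq_zero, not_le]
    positivity
  simp only [opP_eq_lintegral]
  calc ∫⁻ x, (∫⁻ y, subordKernel (weightP α) (t ^ α) (x - y) ∂μ) ^ p
      ≤ (∫⁻ _, ENNReal.ofReal (C * t ^ (-(α * γ))) ∂μ) ^ p :=
        lintegral_rpow_lintegral_le hp
          (F := fun y x => subordKernel (weightP α) (t ^ α) (x - y)) hker measurable_const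
          (Eventually.of_forall fun _ => hpos)
          (Eventually.of_forall fun _ => ENNReal.ofReal_ne_top) (Eventually.of_forall hbound)
    _ ≤ ENNReal.ofReal (m * C * t ^ (-(α * γ))) ^ p := by
        rw [lintegral_const, mul_assoc m, mul_comm m, ENNReal.ofReal_mul (q := m) (by positivity)]
        gcongr

theorem lintegral_duhamelKernel_rpow_le (hp : 1 < p) {C τ : ℝ} (hτ : 0 < τ)
    (hS : negMoment (weightS α) (smoothingExponent N p) ≤ ENNReal.ofReal C) (y : Space N) :
    ∫⁻ x, duhamelKernel α τ (x - y) ^ p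
      ≤ ENNReal.ofReal (τ ^ (α * (1 - smoothingExponent N p) - 1) * C) ^ p := by
  have hp0 : 0 ≤ p := by linarith
  set γ := smoothingExponent N p
  calc ∫⁻ x, duhamelKernel α τ (x - y) ^ p
      = ENNReal.ofReal (τ ^ (α - 1)) ^ p *
          ∫⁻ x, subordKernel (weightS α) (τ ^ α) (x - y) ^ p := by
        simp only [duhamelKernel, ENNReal.mul_rpow_of_nonneg _ _ hp0]
        exact lintegral_const_mul _ (by fun_prop)
    _ ≤ ENNReal.ofReal (τ ^ (α - 1)) ^ p *
          (ENNReal.ofReal ((τ ^ α) ^ (-γ)) * ENNReal.ofReal C) ^ p := by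
        gcongr ENNReal.ofReal (τ ^ (α - 1)) ^ p * ?_
        refine (lintegral_subordKernel_rpow_le hp (measurable_weightS α) (by positivity) y).trans ?_
        gcongr
    _ = ENNReal.ofReal (τ ^ (α * (1 - γ) - 1) * C) ^ p := by
        rw [← ENNReal.mul_rpow_of_nonneg _ _ hp0, ← mul_assoc,
          ← ENNReal.ofReal_mul (by positivity), ← ENNReal.ofReal_mul (by positivity),
          ← Real.rpow_mul hτ.le, ← Real.rpow_add hτ]
        ring_nf

theorem lintegral_duhamel_rpow_le (hp : 1 < p) {C t : ℝ} (hC : 0 < C)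
    (hS : negMoment (weightS α) (smoothingExponent N p) ≤ ENNReal.ofReal C)
    (hu : Measurable fun z : ℝ × Space N => u z.1 z.2) :
    ∫⁻ x, duhamel α p u t x ^ p ≤ (∫⁻ s in Ioo 0 t, (∫⁻ x, u s x ^ p) *
      ENNReal.ofReal ((t - s) ^ (α * (1 - smoothingExponent N p) - 1) * C)) ^ p := by
  set a := α * (1 - smoothingExponent N p)
  have hmem : ∀ᵐ z : ℝ × Space N ∂volume.restrict (Ioo 0 t ×ˢ univ), 0 < t - z.1 := by
    filter_upwards [ae_restrict_mem (measurableSet_Ioo.prod MeasurableSet.univ)] with z hz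
    exact sub_pos.mpr hz.1.2
  have hker : Measurable fun z : (ℝ × Space N) × Space N =>
      duhamelKernel α (t - z.1.1) (z.2 - z.1.2) := by
    fun_prop
  have hweight : Measurable fun z : ℝ × Space N =>
      u z.1 z.2 ^ p * ENNReal.ofReal ((t - z.1) ^ (a - 1) * C) := by
    fun_prop
  calc ∫⁻ x, duhamel α p u t x ^ p
      ≤ (∫⁻ z in Ioo 0 t ×ˢ univ,
          u z.1 z.2 ^ p * ENNReal.ofReal ((t - z.1) ^ (a - 1) * C)) ^ p := by
        refine lintegral_rpow_lintegral_mul_le hp (w := fun z : ℝ × Space N => u z.1 z.2 ^ p)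
          (F := fun z x => duhamelKernel α (t - z.1) (x - z.2))
          (b := fun z => ENNReal.ofReal ((t - z.1) ^ (a - 1) * C)) (by fun_prop) hker (by fun_prop)
          ?_ (Eventually.of_forall fun _ => ENNReal.ofReal_ne_top) ?_
        · filter_upwards [hmem] with z hz
          rw [ne_eq, ENNReal.ofReal_eq_zero, not_le]
          positivity
        · filter_upwards [hmem] with z hz
          exact lintegral_duhamelKernel_rpow_le hp hz hS z.2
    _ = (∫⁻ s in Ioo 0 t, (∫⁻ x, u s x ^ p) * ENNReal.ofReal ((t - s) ^ (a - 1) * C)) ^ p := by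
        rw [Measure.volume_eq_prod, setLIntegral_prod _ hweight.aemeasurable]
        simp only [setLIntegral_univ]
        congr 1
        exact lintegral_congr fun s =>
          lintegral_mul_const _ ((hu.comp measurable_prodMk_left).pow_const p)

theorem LpDecay.setLIntegral_le (hp : 0 < p) {a β B C t : ℝ} (ha : 0 < a) (ha1 : a ≤ 1)
    (hβ : 0 ≤ β) (hβp : β * p < 1) (hB : 0 ≤ B) (hC : 0 ≤ C) (ht : 0 < t)
    (hu : LpDecay p β B u) :
    ∫⁻ s in Ioo 0 t, (∫⁻ x, u s x ^ p) * ENNReal.ofReal ((t - s) ^ (a - 1) * C) ≤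
      ENNReal.ofReal (B ^ p * C * (2 * (1 / a + 1 / (1 - β * p))) * t ^ (-(β * p - a))) := by
  calc ∫⁻ s in Ioo 0 t, (∫⁻ x, u s x ^ p) * ENNReal.ofReal ((t - s) ^ (a - 1) * C)
      ≤ ∫⁻ s in Ioo 0 t, ENNReal.ofReal (B ^ p * C) *
          (ENNReal.ofReal ((t - s) ^ (a - 1)) * ENNReal.ofReal (s ^ ((1 - β * p) - 1))) := by
        refine setLIntegral_mono' measurableSet_Ioo fun s hs => ?_
        have hs0 : 0 < s := hs.1
        have : 0 < t - s := sub_pos.mpr hs.2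
        refine (mul_le_mul_left (hu s hs0) _).trans (le_of_eq ?_)
        rw [ENNReal.ofReal_rpow_of_nonneg (by positivity) hp.le,
          Real.mul_rpow hB (by positivity), ← Real.rpow_mul hs0.le,
          ← ENNReal.ofReal_mul (by positivity), ← ENNReal.ofReal_mul (by positivity),
          ← ENNReal.ofReal_mul (by positivity)]
        ring_nf
    _ ≤ ENNReal.ofReal (B ^ p * C * (2 * (1 / a + 1 / (1 - β * p))) * t ^ (-(β * p - a))) := by
        rw [lintegral_const_mul _ (by fun_prop), mul_assoc (B ^ p * C),
          ENNReal.ofReal_mul (q := 2 * (1 / a + 1 / (1 - β * p)) * t ^ (-(β * p - a)))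
            (by positivity), show -(β * p - a) = a + (1 - β * p) - 1 by ring]
        gcongr
        exact setLIntegral_beta_le ha ha1 (by linarith) (by nlinarith) ht

theorem lpDecay_mildMap [SFinite μ] (hp : 1 < p) (hγ : smoothingExponent N p * p = 1) {C m : ℝ}
    (hα0 : 0 < α) (hα1 : α < 1) (hC : 0 < C) (hm : 0 ≤ m)
    (hP : negMoment (weightP α) (smoothingExponent N p) ≤ ENNReal.ofReal C)
    (hS : negMoment (weightS α) (smoothingExponent N p) ≤ ENNReal.ofReal C)
    (hsmall : (2 * m * C) ^ p *
      (2 * (1 / (α * (1 - smoothingExponent N p)) + 1 / (1 - α))) ≤ m)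
    (hμ : μ univ ≤ ENNReal.ofReal m) (hu : Measurable fun z : ℝ × Space N => u z.1 z.2)
    (hub : LpDecay p (α * smoothingExponent N p) (2 * m * C) u) :
    LpDecay p (α * smoothingExponent N p) (2 * m * C) (mildMap α p μ u) := by
  have hγ0 : 0 < smoothingExponent N p := pos_of_mul_pos_left (hγ ▸ one_pos) (by linarith)
  have hγ1 : smoothingExponent N p < 1 := by nlinarith
  have hopP := lpDecay_opP hp hC hP hμ
  set γ := smoothingExponent N p
  have hβp : α * γ * p = α := by rw [mul_assoc, hγ, mul_one]
  have ha : 0 < α * (1 - γ) := mul_pos hα0 (by linarith)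
  have hduhamel : LpDecay p (α * γ) (m * C) (duhamel α p u) := by
    intro t ht
    have hbound := hub.setLIntegral_le (by linarith) (a := α * (1 - γ)) ha (by nlinarith)
      (by positivity) (by linarith) (by positivity) hC.le ht
    rw [hβp, show α - α * (1 - γ) = α * γ by ring, mul_right_comm _ C] at hbound
    refine (lintegral_duhamel_rpow_le hp hC hS hu).trans (ENNReal.rpow_le_rpow ?_ (by linarith))
    exact hbound.trans (by gcongr)
  have hsum := hopP.add hp.le (by positivity) (by positivity) measurable_opP
    (measurable_duhamel hu) hduhamel
  rw [show m * C + m * C = 2 * m * C by ring] at hsum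
  refine hsum.mono (by linarith) fun t x => ?_
  refine add_le_add_right ?_ _
  exact mul_le_of_le_one_left' (ENNReal.ofReal_le_one.mpr hα1.le)

/-- The Picard iterates of the integral equation, starting from `0`. -/
noncomputable def picardIterate (α p : ℝ) (μ : Measure (Space N)) (n : ℕ) :
    ℝ → Space N → ℝ≥0∞ :=
  (mildMap α p μ)^[n] 0

theorem picardIterate_succ (n : ℕ) :
    picardIterate α p μ (n + 1) = mildMap α p μ (picardIterate α p μ n) :=
  Function.iterate_succ_apply' _ _ _

theorem measurable_picardIterate [SFinite μ] (n : ℕ) :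
    Measurable fun z : ℝ × Space N => picardIterate α p μ n z.1 z.2 := by
  induction n with
  | zero => exact measurable_const
  | succ n ih => rw [picardIterate_succ]; exact measurable_mildMap ih

theorem monotone_picardIterate (hp : 0 ≤ p) : Monotone (picardIterate (N := N) α p μ) :=
  (monotone_mildMap hp).monotone_iterate_of_le_map fun _ _ => zero_le

theorem mildMap_iSup_picardIterate [SFinite μ] (hp : 0 < p) :
    mildMap α p μ (⨆ n, picardIterate α p μ n) = ⨆ n, picardIterate α p μ n := by
  rw [mildMap_iSup hp measurable_picardIterate (monotone_picardIterate hp.le)]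
  simp only [← picardIterate_succ]
  exact (monotone_picardIterate hp.le).iSup_nat_add 1

theorem LpDecay.iSup (hp : 0 < p) {β B : ℝ} {u : ℕ → ℝ → Space N → ℝ≥0∞} (hmono : Monotone u)
    (hu : ∀ n, Measurable fun z : ℝ × Space N => u n z.1 z.2) (hub : ∀ n, LpDecay p β B (u n)) :
    LpDecay p β B (⨆ n, u n) := by
  intro t ht
  have hrpow : ∀ x, (⨆ n, u n t x) ^ p = ⨆ n, u n t x ^ p := fun x =>
    (ENNReal.orderIsoRpow p hp).map_iSup fun n => u n t x
  simp only [iSup_apply, hrpow]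
  have hmeas : ∀ n, Measurable fun x => u n t x ^ p := fun n =>
    ((hu n).comp measurable_prodMk_left).pow_const p
  rw [lintegral_iSup hmeas]
  · exact iSup_le fun n => hub n t ht
  · exact fun m n hmn x => ENNReal.rpow_le_rpow (hmono hmn t x) hp.le

theorem LpDecay.ae_lt_top (hp : 0 < p) {β B t : ℝ} (hub : LpDecay p β B u)
    (hu : Measurable fun z : ℝ × Space N => u z.1 z.2) (ht : 0 < t) : ∀ᵐ x, u t x < ∞ := by
  have hfin : ∫⁻ x, u t x ^ p ≠ ∞ :=
    ((hub t ht).trans_lt (ENNReal.rpow_lt_top_of_nonneg hp.le ENNReal.ofReal_ne_top)).ne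
  filter_upwards [MeasureTheory.ae_lt_top ((hu.comp measurable_prodMk_left).pow_const p) hfin]
    with x hx
  exact (ENNReal.rpow_lt_top_iff_of_pos hp).mp hx

theorem exists_isGlobalSolution [SFinite μ] (hp : 1 < p) (hγ : smoothingExponent N p * p = 1)
    {C m : ℝ} (hα0 : 0 < α) (hα1 : α < 1) (hC : 0 < C) (hm : 0 ≤ m)
    (hP : negMoment (weightP α) (smoothingExponent N p) ≤ ENNReal.ofReal C)
    (hS : negMoment (weightS α) (smoothingExponent N p) ≤ ENNReal.ofReal C)
    (hsmall : (2 * m * C) ^ p *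
      (2 * (1 / (α * (1 - smoothingExponent N p)) + 1 / (1 - α))) ≤ m)
    (hμ : μ univ ≤ ENNReal.ofReal m) : ∃ u, IsGlobalSolution α p μ u := by
  have hp0 : 0 < p := by linarith
  have hdecay : ∀ n, LpDecay p (α * smoothingExponent N p) (2 * m * C)
      (picardIterate α p μ n) := by
    intro n
    induction n with
    | zero => intro t _; simp [picardIterate, hp0]
    | succ n ih =>
      rw [picardIterate_succ]
      exact lpDecay_mildMap hp hγ hα0 hα1 hC hm hP hS hsmall hμ (measurable_picardIterate n) ih
  have hlimit := LpDecay.iSup hp0 (monotone_picardIterate hp0.le) measurable_picardIterate hdecay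
  have hmeas : Measurable fun z : ℝ × Space N => (⨆ n, picardIterate α p μ n) z.1 z.2 := by
    simp only [iSup_apply]
    exact Measurable.iSup measurable_picardIterate
  refine ⟨⨆ n, picardIterate α p μ n, fun T _ => isSolution_iff.mpr
    ⟨hmeas, Eventually.of_forall fun t ht => ?_⟩⟩
  filter_upwards [hlimit.ae_lt_top hp0 hmeas ht.1] with x hx
  exact ⟨hx, by rw [mildMap_iSup_picardIterate hp0]⟩

end Existence

/-! ### Lower bounds for the subordinated heat kernels -/

section KernelLowerBounds

variable {N : ℕ} {w : ℝ → ℝ≥0∞} {σ k : ℝ}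

/-- The constant `c` in the lower bound `c σ^{-N/2}` for subordinated heat kernels at the points
with `‖z‖² ≤ k σ`. -/
noncomputable def kernelConst (N : ℕ) (k : ℝ) : ℝ :=
  1 / 4 * (Real.exp (-(k / 2)) / (6 * Real.pi) ^ ((N : ℝ) / 2))

/-- The volume of the unit ball of `ℝᴺ`, as a real number. -/
noncomputable def unitBallVolume (N : ℕ) : ℝ := (volume (Metric.ball (0 : Space N) 1)).toReal

theorem kernelConst_pos (N : ℕ) (k : ℝ) : 0 < kernelConst N k := by
  unfold kernelConst; positivity

theorem unitBallVolume_pos (N : ℕ) : 0 < unitBallVolume N :=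
  ENNReal.toReal_pos (Metric.measure_ball_pos volume _ one_pos).ne' measure_ball_lt_top.ne

theorem volume_closedBall_sqrt (x : Space N) (hσ : 0 ≤ σ) :
    volume (Metric.closedBall x √σ) = ENNReal.ofReal (σ ^ ((N : ℝ) / 2) * unitBallVolume N) := by
  have hpow : √σ ^ N = σ ^ ((N : ℝ) / 2) := by
    rw [Real.sqrt_eq_rpow, ← Real.rpow_natCast, ← Real.rpow_mul hσ, one_div_mul_eq_div]
  rw [Measure.addHaar_closedBall _ _ (Real.sqrt_nonneg σ), finrank_euclideanSpace_fin, hpow,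
    ENNReal.ofReal_mul (by positivity), unitBallVolume,
    ENNReal.ofReal_toReal measure_ball_lt_top.ne]

theorem le_heatKernel (hσ : 0 < σ) {θ : ℝ} (hθ : θ ∈ Icc (1 / 2 : ℝ) (3 / 2)) {z : Space N}
    (hz : ‖z‖ ^ 2 ≤ k * σ) :
    Real.exp (-(k / 2)) / (6 * Real.pi) ^ ((N : ℝ) / 2) * σ ^ (-((N : ℝ) / 2))
      ≤ heatKernel (σ * θ) z := by
  have hθ0 : 0 < θ := by linarith [hθ.1]
  calc Real.exp (-(k / 2)) / (6 * Real.pi) ^ ((N : ℝ) / 2) * σ ^ (-((N : ℝ) / 2))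
      = 1 / (6 * Real.pi * σ) ^ ((N : ℝ) / 2) * Real.exp (-(k / 2)) := by
        rw [Real.mul_rpow (by positivity) hσ.le, Real.rpow_neg hσ.le]
        field_simp
    _ ≤ 1 / (4 * Real.pi * (σ * θ)) ^ ((N : ℝ) / 2) * Real.exp (-‖z‖ ^ 2 / (4 * (σ * θ))) := by
        gcongr ?_ * Real.exp ?_
        · refine one_div_le_one_div_of_le (by positivity)
            (Real.rpow_le_rpow (by positivity) ?_ (by positivity))
          calc 4 * Real.pi * (σ * θ) = 4 * Real.pi * σ * θ := by ring
            _ ≤ 4 * Real.pi * σ * (3 / 2) := by gcongr; exact hθ.2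
            _ = 6 * Real.pi * σ := by ring
        · rw [neg_div, neg_le_neg_iff, div_le_iff₀ (by positivity)]
          have : 0 ≤ k * σ := (sq_nonneg _).trans hz
          nlinarith [hθ.1]

theorem le_subordKernel (hw : Measurable w) (hconc : ConcentratesNearOne w) (hσ : 0 < σ)
    {z : Space N} (hz : ‖z‖ ^ 2 ≤ k * σ) :
    ENNReal.ofReal (kernelConst N k * σ ^ (-((N : ℝ) / 2))) ≤ subordKernel w σ z := by
  set c := Real.exp (-(k / 2)) / (6 * Real.pi) ^ ((N : ℝ) / 2) * σ ^ (-((N : ℝ) / 2))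
  calc ENNReal.ofReal (kernelConst N k * σ ^ (-((N : ℝ) / 2)))
      = ENNReal.ofReal (1 / 4) * ENNReal.ofReal c := by
        rw [← ENNReal.ofReal_mul (by norm_num), kernelConst, mul_assoc]
    _ ≤ (∫⁻ θ in Icc (1 / 2 : ℝ) (3 / 2), w θ) * ENNReal.ofReal c := by gcongr; exact hconc
    _ = ∫⁻ θ in Icc (1 / 2 : ℝ) (3 / 2), w θ * ENNReal.ofReal c := (lintegral_mul_const _ hw).symm
    _ ≤ ∫⁻ θ in Icc (1 / 2 : ℝ) (3 / 2), w θ * ENNReal.ofReal (heatKernel (σ * θ) z) := by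
        refine setLIntegral_mono' measurableSet_Icc fun θ hθ => ?_
        gcongr
        exact le_heatKernel hσ hθ hz
    _ ≤ subordKernel w σ z :=
        lintegral_mono_set fun θ hθ => mem_Ioi.mpr (by linarith [hθ.1])

theorem mul_measure_le_setLIntegral_subordKernel (hw : Measurable w)
    (hconc : ConcentratesNearOne w) (hσ : 0 < σ) (ν : Measure (Space N)) {s : Set (Space N)}
    (hs : MeasurableSet s) {x : Space N} (hsx : ∀ y ∈ s, ‖x - y‖ ^ 2 ≤ k * σ) :
    ENNReal.ofReal (kernelConst N k * σ ^ (-((N : ℝ) / 2))) * ν s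
      ≤ ∫⁻ y in s, subordKernel w σ (x - y) ∂ν := by
  rw [← setLIntegral_const]
  exact setLIntegral_mono' hs fun y hy => le_subordKernel hw hconc hσ (hsx y hy)

/-- The lower bound for `∫_{B(0, ρ)} subordKernel w σ (x - y) dy` at points `x ∈ B(0, ρ)` with
`σ ≤ ρ²`. -/
noncomputable def ballConst (N : ℕ) : ℝ :=
  kernelConst N 1 * (4 ^ (-((N : ℝ) / 2)) * unitBallVolume N)

theorem ballConst_pos (N : ℕ) : 0 < ballConst N := by
  have := kernelConst_pos N 1
  have := unitBallVolume_pos N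
  unfold ballConst; positivity

theorem exists_closedBall_subset_inter {E : Type*} [NormedAddCommGroup E] [NormedSpace ℝ E]
    {ρ r : ℝ} (hr : 0 < r) (hρ : r ≤ ρ) {x : E} (hx : ‖x‖ ≤ ρ) :
    ∃ z, Metric.closedBall z (r / 2) ⊆ Metric.closedBall 0 ρ ∩ Metric.closedBall x r := by
  have hρ0 : 0 < ρ := hr.trans_le hρ
  set ε := r / (2 * ρ) with hε
  have hε0 : 0 ≤ ε := by positivity
  have hερ : ε * ρ = r / 2 := by rw [hε]; field_simp
  have hε1 : ε ≤ 1 := by rw [hε, div_le_one (by positivity)]; linarith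
  have hx' : ‖(1 - ε) • x‖ ≤ ρ - r / 2 := by
    rw [norm_smul, Real.norm_of_nonneg (by linarith), ← hερ, ← one_sub_mul]
    gcongr
  have hxz : ‖x - (1 - ε) • x‖ ≤ r / 2 := by
    rw [← hερ, sub_smul, one_smul, sub_sub_cancel, norm_smul, Real.norm_of_nonneg hε0]
    gcongr
  refine ⟨(1 - ε) • x, subset_inter (Metric.closedBall_subset_closedBall' ?_)
    (Metric.closedBall_subset_closedBall' ?_)⟩
  · rw [dist_zero_right]; linarith
  · rw [dist_comm, dist_eq_norm]; linarith

theorem le_setLIntegral_subordKernel_closedBall (hw : Measurable w)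
    (hconc : ConcentratesNearOne w) (hσ : 0 < σ) {ρ : ℝ} (hρ : √σ ≤ ρ) {x : Space N}
    (hx : ‖x‖ ≤ ρ) :
    ENNReal.ofReal (ballConst N) ≤ ∫⁻ y in Metric.closedBall 0 ρ, subordKernel w σ (x - y) := by
  obtain ⟨z, hz⟩ := exists_closedBall_subset_inter (Real.sqrt_pos.mpr hσ) hρ hx
  have hnear : ∀ y ∈ Metric.closedBall z (√σ / 2), ‖x - y‖ ^ 2 ≤ 1 * σ := by
    intro y hy
    have hyx : ‖x - y‖ ≤ √σ := mem_closedBall_iff_norm'.mp (hz hy).2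
    calc ‖x - y‖ ^ 2 ≤ √σ ^ 2 := by gcongr
      _ = 1 * σ := by rw [Real.sq_sqrt hσ.le, one_mul]
  have hsqrt : √σ / 2 = √(σ / 4) := by
    rw [Real.sqrt_div hσ.le, show (4 : ℝ) = 2 ^ 2 by norm_num, Real.sqrt_sq (by norm_num)]
  calc ENNReal.ofReal (ballConst N)
      = ENNReal.ofReal (kernelConst N 1 * σ ^ (-((N : ℝ) / 2))) *
          volume (Metric.closedBall z (√σ / 2)) := by
        have := kernelConst_pos N 1
        rw [hsqrt, volume_closedBall_sqrt _ (by positivity), ← ENNReal.ofReal_mul (by positivity),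
          Real.div_rpow hσ.le (by norm_num), ballConst, Real.rpow_neg hσ.le,
          Real.rpow_neg (by norm_num)]
        congr 1
        field_simp
    _ ≤ ∫⁻ y in Metric.closedBall z (√σ / 2), subordKernel w σ (x - y) :=
        mul_measure_le_setLIntegral_subordKernel hw hconc hσ volume
          Metric.isClosed_closedBall.measurableSet hnear
    _ ≤ ∫⁻ y in Metric.closedBall 0 ρ, subordKernel w σ (x - y) :=
        lintegral_mono_set (hz.trans inter_subset_left)

end KernelLowerBounds

/-! ### Propagation of lower bounds -/

section LowerBounds

variable {N : ℕ} {α p : ℝ} {ν : Measure (Space N)} {u : ℝ → Space N → ℝ≥0∞}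

/-- `u` is a global-in-time supersolution of the integral equation. -/
def IsSupersolution (α p : ℝ) (ν : Measure (Space N)) (u : ℝ → Space N → ℝ≥0∞) : Prop :=
  (Measurable fun z : ℝ × Space N => u z.1 z.2) ∧
    ∀ᵐ t : ℝ, 0 < t → ∀ᵐ x : Space N, mildMap α p ν u t x ≤ u t x

theorem IsGlobalSolution.ae_eq_mildMap (h : IsGlobalSolution α p ν u) :
    ∀ᵐ t : ℝ, 0 < t → ∀ᵐ x : Space N, u t x < ∞ ∧ u t x = mildMap α p ν u t x := by
  filter_upwards [ae_all_iff.mpr fun n : ℕ => (isSolution_iff.mp (h (n + 1) (by positivity))).2]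
    with t ht h0
  obtain ⟨n, hn⟩ := exists_nat_ge t
  exact ht n ⟨h0, by linarith⟩

theorem IsGlobalSolution.isSupersolution (h : IsGlobalSolution α p ν u) :
    IsSupersolution α p ν u :=
  ⟨(h 1 one_pos).1, h.ae_eq_mildMap.mono fun _ ht h0 => (ht h0).mono fun _ hx => hx.2.ge⟩

/-- At almost all times `t ∈ I`, the function `u t` is at least `c t` almost everywhere in the ball
of radius `r t` around the origin. -/
def LowerBoundOn (u : ℝ → Space N → ℝ≥0∞) (I : Set ℝ) (r c : ℝ → ℝ) : Prop :=
  ∀ᵐ t : ℝ, t ∈ I → ∀ᵐ x : Space N, ‖x‖ ≤ r t → ENNReal.ofReal (c t) ≤ u t x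

theorem LowerBoundOn.mono {I J : Set ℝ} {r r' c c' : ℝ → ℝ} (h : LowerBoundOn u I r c)
    (hIJ : J ⊆ I) (hr : ∀ t ∈ J, r' t ≤ r t) (hc : ∀ t ∈ J, c' t ≤ c t) :
    LowerBoundOn u J r' c' := by
  filter_upwards [h] with t ht htJ
  filter_upwards [ht (hIJ htJ)] with x hx hxr
  exact (ENNReal.ofReal_le_ofReal (hc t htJ)).trans (hx (hxr.trans (hr t htJ)))

theorem LowerBoundOn.lintegral_le_duhamel (hp : 0 ≤ p)
    (hu : Measurable fun z : ℝ × Space N => u z.1 z.2) {a b t : ℝ} (ha : 0 ≤ a) (hb : b ≤ t)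
    {r c : ℝ → ℝ} (hlow : LowerBoundOn u (Ioo a b) r c) {κ : ℝ → ℝ≥0∞} {x : Space N}
    (hκ : ∀ s ∈ Ioo a b,
      κ s ≤ ∫⁻ y in Metric.closedBall 0 (r s), subordKernel (weightS α) ((t - s) ^ α) (x - y)) :
    ∫⁻ s in Ioo a b, ENNReal.ofReal ((t - s) ^ (α - 1)) * (ENNReal.ofReal (c s) ^ p * κ s)
      ≤ duhamel α p u t x := by
  rw [duhamel_eq_lintegral_opS hu]
  refine le_trans (lintegral_mono_ae ?_) (lintegral_mono_set (Ioo_subset_Ioo ha hb))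
  refine (ae_restrict_iff' measurableSet_Ioo).mpr ?_
  filter_upwards [hlow] with s hs hsm
  have hus : Measurable fun y => u s y ^ p := (hu.comp measurable_prodMk_left).pow_const p
  have hker : Measurable fun y : Space N =>
      subordKernel (weightS α) ((t - s) ^ α) (x - y) := by
    fun_prop
  gcongr
  calc ENNReal.ofReal (c s) ^ p * κ s
      ≤ ∫⁻ y in Metric.closedBall 0 (r s),
          ENNReal.ofReal (c s) ^ p * subordKernel (weightS α) ((t - s) ^ α) (x - y) := by
        rw [lintegral_const_mul _ hker]
        gcongr
        exact hκ s hsm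
    _ ≤ ∫⁻ y in Metric.closedBall 0 (r s),
          u s y ^ p * subordKernel (weightS α) ((t - s) ^ α) (x - y) := by
        refine lintegral_mono_ae ?_
        refine (ae_restrict_iff' Metric.isClosed_closedBall.measurableSet).mpr ?_
        filter_upwards [hs hsm] with y hy hym
        gcongr
        exact hy (mem_closedBall_zero_iff.mp hym)
    _ ≤ ∫⁻ y, u s y ^ p * subordKernel (weightS α) ((t - s) ^ α) (x - y) :=
        setLIntegral_le_lintegral _ _
    _ = opS α (t - s) (volume.withDensity fun y => u s y ^ p) x := by
        rw [opS_eq_lintegral, lintegral_withDensity_eq_lintegral_mul _ hus hker]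
        rfl

end LowerBounds

/-! ### Parabolic lower bounds -/

section Parabolic

variable {N : ℕ} {α p A t₀ : ℝ} {ν : Measure (Space N)} {u : ℝ → Space N → ℝ≥0∞}

/-- The profile `u ≥ A t^{-αN/2}` on `|x| ≤ t^{α/2}`, for `t ≥ t₀`. -/
def ParabolicLowerBound (α : ℝ) (u : ℝ → Space N → ℝ≥0∞) (A t₀ : ℝ) : Prop :=
  LowerBoundOn u (Ici t₀) (fun t => √(t ^ α)) fun t => A * (t ^ α) ^ (-((N : ℝ) / 2))

theorem norm_sub_sq_le_two_mul {E : Type*} [SeminormedAddCommGroup E] (x y : E) :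
    ‖x - y‖ ^ 2 ≤ 2 * (‖x‖ ^ 2 + ‖y‖ ^ 2) :=
  calc ‖x - y‖ ^ 2 ≤ (‖x‖ + ‖y‖) ^ 2 := by gcongr; exact norm_sub_le x y
    _ ≤ 2 * (‖x‖ ^ 2 + ‖y‖ ^ 2) := add_sq_le

theorem IsSupersolution.parabolicLowerBound [SFinite ν] (hα : 0 < α)
    (hconc : ConcentratesNearOne (weightP α))
    (h : IsSupersolution α p ν u) {R m : ℝ} (ht₀ : 0 < t₀) (hR : R ^ 2 ≤ t₀ ^ α)
    (hν : ENNReal.ofReal m ≤ ν (Metric.closedBall 0 R)) :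
    ParabolicLowerBound α u (kernelConst N 4 * m) t₀ := by
  filter_upwards [h.2] with t ht htt
  have ht0 : 0 < t := ht₀.trans_le htt
  filter_upwards [ht ht0] with x hx hxt
  have hR' : R ^ 2 ≤ t ^ α := hR.trans (Real.rpow_le_rpow ht₀.le htt hα.le)
  have hxt' : ‖x‖ ^ 2 ≤ t ^ α := (Real.le_sqrt (norm_nonneg x) (by positivity)).mp hxt
  have hnear : ∀ y ∈ Metric.closedBall 0 R, ‖x - y‖ ^ 2 ≤ 4 * t ^ α := by
    intro y hy
    have hyR : ‖y‖ ^ 2 ≤ R ^ 2 := by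
      gcongr
      exact mem_closedBall_zero_iff.mp hy
    linarith [norm_sub_sq_le_two_mul x y]
  have := kernelConst_pos N 4
  calc ENNReal.ofReal (kernelConst N 4 * m * (t ^ α) ^ (-((N : ℝ) / 2)))
      = ENNReal.ofReal (kernelConst N 4 * (t ^ α) ^ (-((N : ℝ) / 2))) * ENNReal.ofReal m := by
        rw [← ENNReal.ofReal_mul (by positivity), mul_right_comm]
    _ ≤ ENNReal.ofReal (kernelConst N 4 * (t ^ α) ^ (-((N : ℝ) / 2))) *
          ν (Metric.closedBall 0 R) := by gcongr
    _ ≤ ∫⁻ y in Metric.closedBall 0 R, subordKernel (weightP α) (t ^ α) (x - y) ∂ν :=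
        mul_measure_le_setLIntegral_subordKernel (measurable_weightP α) hconc (by positivity) ν
          Metric.isClosed_closedBall.measurableSet hnear
    _ ≤ opP α t ν x := by
        rw [opP_eq_lintegral]
        exact setLIntegral_le_lintegral _ _
    _ ≤ u t x := le_self_add.trans hx

theorem le_setLIntegral_subordKernel_parabolic (hα0 : 0 < α) (hα1 : α ≤ 1)
    (hconc : ConcentratesNearOne (weightS α)) {s t : ℝ} (hs0 : 0 < s) (hst : s < t / 2)
    {x : Space N} (hx : ‖x‖ ≤ √(t ^ α)) :
    ENNReal.ofReal (kernelConst N 8 * (t ^ α) ^ (-((N : ℝ) / 2)) *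
        ((s ^ α) ^ ((N : ℝ) / 2) * unitBallVolume N)) ≤
      ∫⁻ y in Metric.closedBall 0 √(s ^ α), subordKernel (weightS α) ((t - s) ^ α) (x - y) := by
  have ht0 : 0 < t := by linarith
  have hts0 : 0 < t - s := by linarith
  have hxt : ‖x‖ ^ 2 ≤ t ^ α := (Real.le_sqrt (norm_nonneg x) (by positivity)).mp hx
  have hnear : ∀ y ∈ Metric.closedBall (0 : Space N) √(s ^ α), ‖x - y‖ ^ 2 ≤ 8 * (t - s) ^ α := by
    intro y hy
    have hys : ‖y‖ ^ 2 ≤ s ^ α :=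
      (Real.le_sqrt (norm_nonneg y) (by positivity)).mp (mem_closedBall_zero_iff.mp hy)
    have hsα : s ^ α ≤ t ^ α := Real.rpow_le_rpow hs0.le (by linarith) hα0.le
    have htα : t ^ α ≤ 2 * (t - s) ^ α := by
      calc t ^ α ≤ (2 * (t - s)) ^ α := Real.rpow_le_rpow ht0.le (by linarith) hα0.le
        _ = 2 ^ α * (t - s) ^ α := Real.mul_rpow (by norm_num) hts0.le
        _ ≤ 2 * (t - s) ^ α := by
          gcongr
          exact Real.rpow_le_self_of_one_le (by norm_num) hα1
    linarith [norm_sub_sq_le_two_mul x y]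
  have := kernelConst_pos N 8
  have := unitBallVolume_pos N
  calc ENNReal.ofReal (kernelConst N 8 * (t ^ α) ^ (-((N : ℝ) / 2)) *
          ((s ^ α) ^ ((N : ℝ) / 2) * unitBallVolume N))
      ≤ ENNReal.ofReal (kernelConst N 8 * ((t - s) ^ α) ^ (-((N : ℝ) / 2)) *
          ((s ^ α) ^ ((N : ℝ) / 2) * unitBallVolume N)) := by
        gcongr ENNReal.ofReal (_ * ?_ * _)
        refine Real.rpow_le_rpow_of_nonpos (by positivity) ?_ (neg_nonpos.mpr (by positivity))
        exact Real.rpow_le_rpow hts0.le (by linarith) hα0.le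
    _ = ENNReal.ofReal (kernelConst N 8 * ((t - s) ^ α) ^ (-((N : ℝ) / 2))) *
          volume (Metric.closedBall (0 : Space N) √(s ^ α)) := by
        rw [ENNReal.ofReal_mul (by positivity), volume_closedBall_sqrt _ (by positivity)]
    _ ≤ ∫⁻ y in Metric.closedBall 0 √(s ^ α), subordKernel (weightS α) ((t - s) ^ α) (x - y) :=
        mul_measure_le_setLIntegral_subordKernel (measurable_weightS α) hconc (by positivity)
          volume Metric.isClosed_closedBall.measurableSet hnear

theorem le_setLIntegral_Ioo_rpow_neg {t : ℝ} (hα0 : 0 ≤ α) (hα1 : α < 1) (ht₀ : 0 < t₀)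
    (ht : 2 * 2 ^ (1 / (1 - α)) * t₀ ≤ t) :
    ENNReal.ofReal (t ^ (1 - α) / (4 * (1 - α)))
      ≤ ∫⁻ s in Ioo t₀ (t / 2), ENNReal.ofReal (s ^ (-α)) := by
  have hβ : 0 < 1 - α := by linarith
  have ht0 : 0 < t := lt_of_lt_of_le (by positivity) ht
  have hsmall : 2 * t₀ ^ (1 - α) ≤ (t / 2) ^ (1 - α) := by
    calc 2 * t₀ ^ (1 - α) = (2 ^ (1 / (1 - α)) * t₀) ^ (1 - α) := by
          rw [Real.mul_rpow (by positivity) ht₀.le, ← Real.rpow_mul (by norm_num),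
            one_div_mul_cancel hβ.ne', Real.rpow_one]
      _ ≤ (t / 2) ^ (1 - α) := Real.rpow_le_rpow (by positivity) (by linarith) hβ.le
  have hhalf : t ^ (1 - α) ≤ 2 * (t / 2) ^ (1 - α) := by
    calc t ^ (1 - α) = 2 ^ (1 - α) * (t / 2) ^ (1 - α) := by
          rw [← Real.mul_rpow (by norm_num) (by positivity), mul_div_cancel₀ t two_ne_zero]
      _ ≤ 2 * (t / 2) ^ (1 - α) := by
          gcongr
          exact Real.rpow_le_self_of_one_le (by norm_num) (by linarith)
  have hsplit := setLIntegral_Ioo_le_add (fun s => ENNReal.ofReal (s ^ (-α))) 0 t₀ (t / 2)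
  simp only [← sub_sub_cancel_left (1 : ℝ) α] at hsplit ⊢
  rw [setLIntegral_Ioo_rpow hβ (by positivity), setLIntegral_Ioo_rpow hβ ht₀.le] at hsplit
  refine le_trans ?_ (tsub_le_iff_left.mpr hsplit)
  rw [← ENNReal.ofReal_sub _ (by positivity), ← sub_div, ← div_div]
  gcongr
  linarith

/-- The factor by which an amplitude `A` improves in one step is
`gainConst N * A ^ (p - 1) / (1 - α)`. -/
noncomputable def gainConst (N : ℕ) : ℝ := kernelConst N 8 * unitBallVolume N / 8

theorem gainConst_pos (N : ℕ) : 0 < gainConst N := by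
  have := kernelConst_pos N 8
  have := unitBallVolume_pos N
  unfold gainConst; positivity

theorem critical_amplitude_mul (hp : 0 ≤ p) (hNp : (N : ℝ) / 2 * (p - 1) = 1) (hA : 0 ≤ A)
    {s : ℝ} (hs : 0 < s) (c d : ℝ) :
    ENNReal.ofReal (A * (s ^ α) ^ (-((N : ℝ) / 2))) ^ p *
        ENNReal.ofReal (c * ((s ^ α) ^ ((N : ℝ) / 2) * d))
      = ENNReal.ofReal (A ^ p * c * d * s ^ (-α)) := by
  have hpow : ((s ^ α) ^ (-((N : ℝ) / 2))) ^ p * (s ^ α) ^ ((N : ℝ) / 2) = s ^ (-α) := by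
    rw [← Real.rpow_mul (by positivity), ← Real.rpow_add (by positivity), ← Real.rpow_mul hs.le]
    congr 1
    linear_combination -α * hNp
  rw [ENNReal.ofReal_rpow_of_nonneg (by positivity) hp, ← ENNReal.ofReal_mul (by positivity),
    Real.mul_rpow hA (by positivity), ← hpow]
  congr 1
  ring

theorem ParabolicLowerBound.mul_setLIntegral_le_duhamel (hα0 : 0 < α) (hα1 : α ≤ 1) (hp : 0 ≤ p)
    (hNp : (N : ℝ) / 2 * (p - 1) = 1) (hconc : ConcentratesNearOne (weightS α))
    (hu : Measurable fun z : ℝ × Space N => u z.1 z.2) (hA : 0 ≤ A) (ht₀ : 0 < t₀)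
    (hlow : ParabolicLowerBound α u A t₀) {t : ℝ} (ht : 0 < t) {x : Space N}
    (hx : ‖x‖ ≤ √(t ^ α)) :
    ENNReal.ofReal (t ^ (α - 1) * (A ^ p * (kernelConst N 8 * (t ^ α) ^ (-((N : ℝ) / 2))) *
        unitBallVolume N)) * ∫⁻ s in Ioo t₀ (t / 2), ENNReal.ofReal (s ^ (-α))
      ≤ duhamel α p u t x := by
  have hlow' : LowerBoundOn u (Ioo t₀ (t / 2)) (fun s => √(s ^ α))
      fun s => A * (s ^ α) ^ (-((N : ℝ) / 2)) :=
    hlow.mono (Ioo_subset_Ioi_self.trans Ioi_subset_Ici_self) (fun _ _ => le_rfl) fun _ _ => le_rfl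
  refine le_trans ?_ (hlow'.lintegral_le_duhamel hp hu ht₀.le (by linarith) fun s hs =>
    le_setLIntegral_subordKernel_parabolic hα0 hα1 hconc (ht₀.trans hs.1) hs.2 hx)
  rw [← lintegral_const_mul _ (by fun_prop)]
  refine setLIntegral_mono' measurableSet_Ioo fun s hs => ?_
  rw [critical_amplitude_mul hp hNp hA (ht₀.trans hs.1)]
  set M := A ^ p * (kernelConst N 8 * (t ^ α) ^ (-((N : ℝ) / 2))) * unitBallVolume N
  have hM0 : 0 ≤ M := by
    have := unitBallVolume_pos N
    have := kernelConst_pos N 8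
    positivity
  rw [ENNReal.ofReal_mul (by positivity), ENNReal.ofReal_mul (p := M) hM0, mul_assoc]
  gcongr ENNReal.ofReal ?_ * _
  exact Real.rpow_le_rpow_of_nonpos (by linarith [hs.1, hs.2]) (by linarith [hs.1]) (by linarith)

theorem IsSupersolution.parabolicLowerBound_step (hα0 : 1 / 2 ≤ α) (hα1 : α < 1) (hp : 0 ≤ p)
    (hNp : (N : ℝ) / 2 * (p - 1) = 1) (hconc : ConcentratesNearOne (weightS α))
    (h : IsSupersolution α p ν u) (hA : 0 ≤ A) (ht₀ : 0 < t₀)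
    (hlow : ParabolicLowerBound α u A t₀) :
    ParabolicLowerBound α u (gainConst N * A ^ p / (1 - α)) (2 * 2 ^ (1 / (1 - α)) * t₀) := by
  have hβ : 0 < 1 - α := by linarith
  have hα : 0 < α := by linarith
  filter_upwards [h.2] with t ht htt
  have ht0 : 0 < t := lt_of_lt_of_le (by positivity) htt
  filter_upwards [ht ht0] with x hx hxt
  set M := A ^ p * (kernelConst N 8 * (t ^ α) ^ (-((N : ℝ) / 2))) * unitBallVolume N with hM
  have hM0 : 0 ≤ M := by
    have := unitBallVolume_pos N
    have := kernelConst_pos N 8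
    positivity
  have hcancel : t ^ (α - 1) * t ^ (1 - α) = 1 := by
    rw [← Real.rpow_add ht0, sub_add_sub_cancel, sub_self, Real.rpow_zero]
  calc ENNReal.ofReal (gainConst N * A ^ p / (1 - α) * (t ^ α) ^ (-((N : ℝ) / 2)))
      = ENNReal.ofReal (1 / 2 * (t ^ (α - 1) * M * (t ^ (1 - α) / (4 * (1 - α))))) := by
        congr 1
        rw [hM, gainConst]
        field_simp
        linear_combination -8 * kernelConst N 8 * unitBallVolume N * A ^ p * hcancel
    _ ≤ ENNReal.ofReal (α * (t ^ (α - 1) * M * (t ^ (1 - α) / (4 * (1 - α))))) := by gcongr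
    _ ≤ ENNReal.ofReal α * (ENNReal.ofReal (t ^ (α - 1) * M) *
          ∫⁻ s in Ioo t₀ (t / 2), ENNReal.ofReal (s ^ (-α))) := by
        rw [ENNReal.ofReal_mul hα.le, ENNReal.ofReal_mul (by positivity)]
        gcongr
        exact le_setLIntegral_Ioo_rpow_neg hα.le hα1 ht₀ htt
    _ ≤ ENNReal.ofReal α * duhamel α p u t x := by
        gcongr
        exact hlow.mul_setLIntegral_le_duhamel hα hα1.le hp hNp hconc h.1 hA ht₀ ht0 hxt
    _ ≤ u t x := le_add_self.trans hx

theorem IsSupersolution.exists_parabolicLowerBound_two_pow_mul (hα0 : 1 / 2 ≤ α) (hα1 : α < 1)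
    (hp : 1 ≤ p) (hNp : (N : ℝ) / 2 * (p - 1) = 1) (hconc : ConcentratesNearOne (weightS α))
    (h : IsSupersolution α p ν u) (hA : 0 < A) (ht₀ : 0 < t₀)
    (hlow : ParabolicLowerBound α u A t₀)
    (hbig : 2 * (1 - α) ≤ gainConst N * A ^ (p - 1)) (n : ℕ) :
    ∃ T : ℝ, 0 < T ∧ ParabolicLowerBound α u (2 ^ n * A) T := by
  have hβ : 0 < 1 - α := by linarith
  have hg := gainConst_pos N
  induction n with
  | zero => exact ⟨t₀, ht₀, by simpa using hlow⟩
  | succ n ih =>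
    obtain ⟨T, hT, hlowT⟩ := ih
    have hdouble : 2 ^ (n + 1) * A ≤ gainConst N * (2 ^ n * A) ^ p / (1 - α) := by
      rw [le_div_iff₀ hβ]
      calc 2 ^ (n + 1) * A * (1 - α) = 2 * (1 - α) * (2 ^ n * A) := by ring
        _ ≤ gainConst N * A ^ (p - 1) * (2 ^ n * A) := by gcongr
        _ ≤ gainConst N * (2 ^ n * A) ^ (p - 1) * (2 ^ n * A) := by
            gcongr
            exact le_mul_of_one_le_left hA.le (one_le_pow₀ (by norm_num))
        _ = gainConst N * (2 ^ n * A) ^ p := by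
            rw [mul_assoc, ← Real.rpow_add_one (by positivity), sub_add_cancel]
    refine ⟨_, by positivity, (h.parabolicLowerBound_step hα0 hα1 (by linarith) hNp hconc
      (by positivity) hT hlowT).mono subset_rfl (fun _ _ => le_rfl) fun t ht => ?_⟩
    have : 0 < t := lt_of_lt_of_le (by positivity) (mem_Ici.mp ht)
    gcongr

end Parabolic

/-! ### Blow-up -/

section BlowUp

variable {N : ℕ} {α p T : ℝ} {ν : Measure (Space N)} {u : ℝ → Space N → ℝ≥0∞}

theorem IsSupersolution.lowerBoundOn_step (hα : 0 < α) (hp : 0 ≤ p)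
    (hconc : ConcentratesNearOne (weightS α)) (h : IsSupersolution α p ν u) {ρ τ δ D b : ℝ}
    (hτ : 0 ≤ τ) (hδ : 0 < δ) (hδρ : √(δ ^ α) ≤ ρ) (hD : 0 ≤ D)
    (hlow : LowerBoundOn u (Icc τ b) (fun _ => ρ) fun _ => D) :
    LowerBoundOn u (Icc (τ + δ) b) (fun _ => ρ) fun _ => ballConst N * D ^ p * δ ^ α := by
  have hc := ballConst_pos N
  filter_upwards [h.2] with t ht htm
  filter_upwards [ht (by linarith [htm.1])] with x hx hxρ
  have hlow' : LowerBoundOn u (Ioo (t - δ) t) (fun _ => ρ) fun _ => D :=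
    hlow.mono (fun s hs => ⟨by linarith [htm.1, hs.1], by linarith [htm.2, hs.2]⟩)
      (fun _ _ => le_rfl) fun _ _ => le_rfl
  have hκ : ∀ s ∈ Ioo (t - δ) t, ENNReal.ofReal (ballConst N) ≤
      ∫⁻ y in Metric.closedBall 0 ρ, subordKernel (weightS α) ((t - s) ^ α) (x - y) := by
    intro s hs
    have hts : 0 < t - s := by linarith [hs.2]
    have hσρ : √((t - s) ^ α) ≤ ρ :=
      (Real.sqrt_le_sqrt (Real.rpow_le_rpow hts.le (by linarith [hs.1]) hα.le)).trans hδρ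
    exact le_setLIntegral_subordKernel_closedBall (measurable_weightS α) hconc (by positivity)
      hσρ hxρ
  calc ENNReal.ofReal (ballConst N * D ^ p * δ ^ α)
      = ENNReal.ofReal α * (ENNReal.ofReal (δ ^ α / α) *
          (ENNReal.ofReal D ^ p * ENNReal.ofReal (ballConst N))) := by
        rw [ENNReal.ofReal_rpow_of_nonneg hD hp, ← ENNReal.ofReal_mul (by positivity),
          ← ENNReal.ofReal_mul (by positivity), ← ENNReal.ofReal_mul hα.le]
        congr 1
        field_simp
    _ = ENNReal.ofReal α * ∫⁻ s in Ioo (t - δ) t, ENNReal.ofReal ((t - s) ^ (α - 1)) *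
          (ENNReal.ofReal D ^ p * ENNReal.ofReal (ballConst N)) := by
        rw [lintegral_mul_const _ (by fun_prop), setLIntegral_Ioo_sub_rpow hα (by linarith),
          sub_sub_cancel]
    _ ≤ ENNReal.ofReal α * duhamel α p u t x := by
        gcongr
        exact hlow'.lintegral_le_duhamel hp h.1 (by linarith [htm.1]) le_rfl hκ
    _ ≤ u t x := le_add_self.trans hx

theorem mul_pow_succ_le_mul_rpow {B D r : ℝ} (hα1 : α ≤ 1) (hB : 0 ≤ B) (hD : 0 < D)
    (hT : 0 ≤ T) (hr : 0 < r) (hrp : r ^ (p - 1) = 2) (hgain : 4 * r ≤ B * D ^ (p - 1) * T ^ α)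
    (n : ℕ) :
    D * r ^ (n + 1) ≤ B * (D * r ^ n) ^ p * (T * (1 / 2) ^ (n + 2)) ^ α := by
  have hpow : (D * r ^ n) ^ p = D ^ (p - 1) * 2 ^ n * (D * r ^ n) := by
    rw [← hrp, Real.rpow_pow_comm hr.le, ← Real.mul_rpow hD.le (by positivity),
      ← Real.rpow_add_one (by positivity), sub_add_cancel]
  have htime : T ^ α * (1 / 2) ^ (n + 2) ≤ (T * (1 / 2) ^ (n + 2)) ^ α := by
    rw [Real.mul_rpow hT (by positivity)]
    gcongr
    exact Real.self_le_rpow_of_le_one (by positivity) (pow_le_one₀ (by norm_num) (by norm_num)) hα1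
  have htwo : (2 : ℝ) ^ n * (1 / 2) ^ (n + 2) = 1 / 4 := by
    rw [pow_add, ← mul_assoc, ← mul_pow]; norm_num
  calc D * r ^ (n + 1) = 4 * r * (1 / 4) * (D * r ^ n) := by ring
    _ ≤ B * D ^ (p - 1) * T ^ α * (1 / 4) * (D * r ^ n) := by gcongr
    _ = B * (D ^ (p - 1) * 2 ^ n * (D * r ^ n)) * (T ^ α * (1 / 2) ^ (n + 2)) := by
        rw [← htwo]; ring
    _ ≤ B * (D * r ^ n) ^ p * (T * (1 / 2) ^ (n + 2)) ^ α := by rw [hpow]; gcongr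

theorem IsSupersolution.lowerBoundOn_geometric (hα0 : 0 < α) (hα1 : α ≤ 1) (hp : 0 ≤ p)
    (hconc : ConcentratesNearOne (weightS α)) (h : IsSupersolution α p ν u) {D r : ℝ} (hT : 0 < T)
    (hD : 0 < D) (hr : 0 < r) (hrp : r ^ (p - 1) = 2)
    (hgain : 4 * r ≤ ballConst N * D ^ (p - 1) * T ^ α)
    (hlow : LowerBoundOn u (Icc T (2 * T)) (fun _ => √(T ^ α)) fun _ => D) (n : ℕ) :
    LowerBoundOn u (Icc (T * (3 / 2 - (1 / 2) ^ (n + 1))) (2 * T)) (fun _ => √(T ^ α))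
      fun _ => D * r ^ n := by
  induction n with
  | zero =>
    convert hlow using 2
    all_goals norm_num
  | succ n ih =>
    have hhalf (k : ℕ) : (1 / 2 : ℝ) ^ k ≤ 1 := pow_le_one₀ (by norm_num) (by norm_num)
    have hstart : 0 ≤ T * (3 / 2 - (1 / 2) ^ (n + 1)) :=
      mul_nonneg hT.le (by linarith [hhalf (n + 1)])
    have hδ : √((T * (1 / 2) ^ (n + 2)) ^ α) ≤ √(T ^ α) := by
      gcongr
      exact mul_le_of_le_one_right hT.le (hhalf _)
    refine (h.lowerBoundOn_step hα0 hp hconc hstart (by positivity) hδ (by positivity) ih).mono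
      (Icc_subset_Icc_left ?_) (fun _ _ => le_rfl) fun _ _ =>
        mul_pow_succ_le_mul_rpow hα1 (ballConst_pos N).le hD hT.le hr hrp hgain n
    exact le_of_eq (by ring)

theorem not_ae_lt_top_of_lowerBoundOn {I : Set ℝ} (hI : volume I ≠ 0) {ρ : ℝ} (hρ : 0 < ρ)
    {c : ℕ → ℝ} (hc : Tendsto c atTop atTop)
    (hlow : ∀ n, LowerBoundOn u I (fun _ => ρ) fun _ => c n) :
    ¬ ∀ᵐ t : ℝ, t ∈ I → ∀ᵐ x : Space N, u t x < ∞ := by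
  intro hfin
  obtain ⟨t, htI, ht, hts⟩ := Measure.exists_mem_of_measure_ne_zero_of_ae hI
    (ae_restrict_of_ae ((ae_all_iff.mpr hlow).and hfin))
  obtain ⟨x, hxρ, hx, hxs⟩ := Measure.exists_mem_of_measure_ne_zero_of_ae
    (Metric.measure_closedBall_pos volume (0 : Space N) hρ).ne'
    (ae_restrict_of_ae ((ae_all_iff.mpr fun n => ht n htI).and (hts htI)))
  obtain ⟨n, hn⟩ := (hc.eventually_gt_atTop (u t x).toReal).exists
  have hle := hx n (mem_closedBall_zero_iff.mp hxρ)
  rw [ENNReal.ofReal_le_iff_le_toReal hxs.ne] at hle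
  linarith

theorem ParabolicLowerBound.lowerBoundOn {A : ℝ} (hα : 0 ≤ α) (hA : 0 ≤ A) (hT : 0 < T)
    (hlow : ParabolicLowerBound α u A T) :
    LowerBoundOn u (Icc T (2 * T)) (fun _ => √(T ^ α))
      fun _ => A * ((2 * T) ^ α) ^ (-((N : ℝ) / 2)) := by
  refine hlow.mono Icc_subset_Ici_self (fun t ht => ?_) fun t ht => ?_
  · have := ht.1
    gcongr
  · have ht0 : 0 < t := hT.trans_le ht.1
    refine mul_le_mul_of_nonneg_left ?_ hA
    exact Real.rpow_le_rpow_of_nonpos (by positivity) (Real.rpow_le_rpow ht0.le ht.2 hα)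
      (neg_nonpos.mpr (by positivity))

theorem critical_amplitude_rpow {A σ : ℝ} (hNp : (N : ℝ) / 2 * (p - 1) = 1) (hA : 0 ≤ A)
    (hσ : 0 ≤ σ) : (A * σ ^ (-((N : ℝ) / 2))) ^ (p - 1) = A ^ (p - 1) / σ := by
  rw [Real.mul_rpow hA (by positivity), ← Real.rpow_mul hσ, neg_mul, hNp, Real.rpow_neg_one,
    div_eq_mul_inv]

theorem IsSupersolution.not_parabolicLowerBound (hα0 : 0 < α) (hα1 : α ≤ 1) (hp : 1 < p)
    (hNp : (N : ℝ) / 2 * (p - 1) = 1) (hconc : ConcentratesNearOne (weightS α))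
    (h : IsSupersolution α p ν u) (hfin : ∀ᵐ t : ℝ, 0 < t → ∀ᵐ x : Space N, u t x < ∞) {A : ℝ}
    (hA : 0 < A) (hT : 0 < T) (hbig : 8 * 2 ^ (1 / (p - 1)) ≤ ballConst N * A ^ (p - 1)) :
    ¬ ParabolicLowerBound α u A T := by
  intro hlow
  have hp1 : 0 < p - 1 := by linarith
  have := ballConst_pos N
  set r : ℝ := 2 ^ (1 / (p - 1)) with hr
  have hr1 : 1 < r := Real.one_lt_rpow (by norm_num) (by positivity)
  have hrp : r ^ (p - 1) = 2 := by
    rw [hr, ← Real.rpow_mul (by norm_num), one_div_mul_cancel hp1.ne', Real.rpow_one]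
  set D := A * ((2 * T) ^ α) ^ (-((N : ℝ) / 2)) with hD
  have hD0 : 0 < D := by positivity
  have hgain : 4 * r ≤ ballConst N * D ^ (p - 1) * T ^ α := by
    have hdouble : (2 * T) ^ α ≤ 2 * T ^ α := by
      rw [Real.mul_rpow (by norm_num) hT.le]
      gcongr
      exact Real.rpow_le_self_of_one_le (by norm_num) hα1
    rw [hD, critical_amplitude_rpow hNp hA.le (by positivity), ← mul_div_assoc, div_mul_eq_mul_div,
      le_div_iff₀ (by positivity)]
    calc 4 * r * (2 * T) ^ α ≤ 4 * r * (2 * T ^ α) := by gcongr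
      _ = 8 * r * T ^ α := by ring
      _ ≤ ballConst N * A ^ (p - 1) * T ^ α := by gcongr
  have hgeom := h.lowerBoundOn_geometric hα0 hα1 (by linarith) hconc hT hD0 (by positivity) hrp
    hgain (hlow.lowerBoundOn hα0.le hA.le hT)
  have hI : volume (Icc (3 / 2 * T) (2 * T)) ≠ 0 := by
    rw [Real.volume_Icc, ne_eq, ENNReal.ofReal_eq_zero, not_le]
    linarith
  refine not_ae_lt_top_of_lowerBoundOn hI (ρ := √(T ^ α)) (Real.sqrt_pos.mpr (by positivity))
    ((tendsto_pow_atTop_atTop_of_one_lt hr1).const_mul_atTop hD0) (fun n => ?_)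
    (hfin.mono fun t ht htI => ht (lt_of_lt_of_le (by positivity) htI.1))
  refine (hgeom n).mono (Icc_subset_Icc_left ?_) (fun _ _ => le_rfl) fun _ _ => le_rfl
  rw [mul_comm]
  gcongr
  exact sub_le_self _ (by positivity)

theorem IsGlobalSolution.measure_closedBall_le (hα0 : 1 / 2 ≤ α) (hα1 : α < 1) (hp : 1 < p)
    (hNp : (N : ℝ) / 2 * (p - 1) = 1) (hconcP : ConcentratesNearOne (weightP α))
    (hconcS : ConcentratesNearOne (weightS α)) [SFinite ν] (h : IsGlobalSolution α p ν u) {m : ℝ}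
    (hm : 0 < m) (hbig : 2 * (1 - α) ≤ gainConst N * (kernelConst N 4 * m) ^ (p - 1)) (R : ℝ) :
    ν (Metric.closedBall 0 R) ≤ ENNReal.ofReal m := by
  by_contra! hlt
  have hα : 0 < α := by linarith
  have hp1 : 0 < p - 1 := by linarith
  have hA : 0 < kernelConst N 4 * m := mul_pos (kernelConst_pos N 4) hm
  have ht₀ : 0 < (R ^ 2 + 1) ^ (1 / α) := by positivity
  have hR : R ^ 2 ≤ ((R ^ 2 + 1) ^ (1 / α)) ^ α := by
    rw [← Real.rpow_mul (by positivity), one_div_mul_cancel hα.ne', Real.rpow_one]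
    linarith
  have hlow := h.isSupersolution.parabolicLowerBound hα hconcP ht₀ hR hlt.le
  have htend : Tendsto (fun n : ℕ => ballConst N * (2 ^ n * (kernelConst N 4 * m)) ^ (p - 1))
      atTop atTop := by
    refine Tendsto.const_mul_atTop (ballConst_pos N) ((tendsto_rpow_atTop hp1).comp ?_)
    exact (tendsto_pow_atTop_atTop_of_one_lt (by norm_num)).atTop_mul_const hA
  obtain ⟨n, hn⟩ := (htend.eventually_ge_atTop (8 * 2 ^ (1 / (p - 1)))).exists
  obtain ⟨T, hT, hlowT⟩ := h.isSupersolution.exists_parabolicLowerBound_two_pow_mul hα0 hα1 hp.le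
    hNp hconcS hA ht₀ hlow hbig n
  exact h.isSupersolution.not_parabolicLowerBound hα hα1.le hp hNp hconcS
    (h.ae_eq_mildMap.mono fun t ht h0 => (ht h0).mono fun x hx => hx.1) (by positivity) hT hn hlowT

theorem IsGlobalSolution.measure_univ_le (hα0 : 1 / 2 ≤ α) (hα1 : α < 1) (hp : 1 < p)
    (hNp : (N : ℝ) / 2 * (p - 1) = 1) (hconcP : ConcentratesNearOne (weightP α))
    (hconcS : ConcentratesNearOne (weightS α)) [SFinite ν] (h : IsGlobalSolution α p ν u) {m : ℝ}
    (hm : 0 < m) (hbig : 2 * (1 - α) ≤ gainConst N * (kernelConst N 4 * m) ^ (p - 1)) :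
    ν univ ≤ ENNReal.ofReal m := by
  have hmono : Monotone fun n : ℕ => Metric.closedBall (0 : Space N) n := fun _ _ hab =>
    Metric.closedBall_subset_closedBall (Nat.cast_le.mpr hab)
  rw [← Metric.iUnion_closedBall_nat (0 : Space N), hmono.measure_iUnion]
  exact iSup_le fun n => h.measure_closedBall_le hα0 hα1 hp hNp hconcP hconcS hm hbig n

end BlowUp

/-! ### The threshold -/

section Threshold

variable {N : ℕ}

theorem one_lt_fujitaExponent (hN : N ≠ 0) : 1 < fujitaExponent N := by
  have : (0 : ℝ) < N := by exact_mod_cast Nat.pos_of_ne_zero hN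
  exact lt_add_of_pos_right _ (by positivity)

theorem half_mul_fujitaExponent_sub_one (hN : N ≠ 0) :
    (N : ℝ) / 2 * (fujitaExponent N - 1) = 1 := by
  have : (N : ℝ) ≠ 0 := Nat.cast_ne_zero.mpr hN
  rw [fujitaExponent, add_sub_cancel_left]
  field_simp

theorem threshold_rpow {p c β : ℝ} (hNp : (N : ℝ) / 2 * (p - 1) = 1) (hc : 0 ≤ c) (hβ : 0 ≤ β) :
    (c ^ (1 / (p - 1)) * β ^ ((N : ℝ) / 2)) ^ (p - 1) = c * β := by
  have hp : p - 1 ≠ 0 := right_ne_zero_of_mul_eq_one hNp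
  rw [Real.mul_rpow (by positivity) (by positivity), ← Real.rpow_mul hc, ← Real.rpow_mul hβ, hNp,
    one_div_mul_cancel hp, Real.rpow_one, Real.rpow_one]

theorem eventually_mem_Ioo_half_one : ∀ᶠ α : ℝ in 𝓝[<] 1, α ∈ Ioo (1 / 2) 1 :=
  Ioo_mem_nhdsLT (by norm_num)

theorem tendsto_ofReal_mul_one_sub_rpow (C : ℝ) {q : ℝ} (hq : 0 < q) :
    Tendsto (fun α : ℝ => ENNReal.ofReal (C * (1 - α) ^ q)) (𝓝[<] 1) (𝓝 0) := by
  have hcont : Continuous fun α : ℝ => ENNReal.ofReal (C * (1 - α) ^ q) :=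
    ENNReal.continuous_ofReal.comp <| continuous_const.mul <|
      (continuous_const.sub continuous_id).rpow_const fun _ => Or.inr hq.le
  refine (hcont.tendsto' 1 0 ?_).mono_left nhdsWithin_le_nhds
  rw [sub_self, Real.zero_rpow hq.ne', mul_zero, ENNReal.ofReal_zero]

theorem exists_smallness_const {p γ C : ℝ} (hγ : γ < 1) (hC : 0 < C) :
    ∃ c : ℝ, 0 < c ∧ ∀ α ∈ Ioo (1 / 2 : ℝ) 1, ∀ m : ℝ, 0 < m → m ^ (p - 1) ≤ c * (1 - α) →
      (2 * m * C) ^ p * (2 * (1 / (α * (1 - γ)) + 1 / (1 - α))) ≤ m := by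
  have : 0 < 1 - γ := by linarith
  set K : ℝ := 2 * (1 / (1 / 2 * (1 - γ)) + 1) with hK
  set Q : ℝ := (2 * C) ^ p * K with hQ
  have hQ0 : 0 < Q := by positivity
  refine ⟨Q⁻¹, by positivity, fun α hα m hm hmp => ?_⟩
  have hβ : 0 < 1 - α := by linarith [hα.2]
  have hbeta : 2 * (1 / (α * (1 - γ)) + 1 / (1 - α)) ≤ K / (1 - α) := by
    have hα_half : 1 / (α * (1 - γ)) ≤ 1 / (1 / 2 * (1 - γ)) := by
      gcongr
      exact hα.1.le
    have hdiv : 1 / (1 / 2 * (1 - γ)) ≤ 1 / (1 / 2 * (1 - γ)) / (1 - α) :=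
      le_div_self (by positivity) hβ (by linarith [hα.1])
    calc 2 * (1 / (α * (1 - γ)) + 1 / (1 - α))
        ≤ 2 * (1 / (1 / 2 * (1 - γ)) / (1 - α) + 1 / (1 - α)) := by
          gcongr 2 * (?_ + _)
          exact hα_half.trans hdiv
      _ = K / (1 - α) := by rw [hK]; ring
  calc (2 * m * C) ^ p * (2 * (1 / (α * (1 - γ)) + 1 / (1 - α)))
      ≤ (2 * C * m) ^ p * (K / (1 - α)) := by rw [mul_right_comm]; gcongr
    _ = Q * m ^ (p - 1) * m / (1 - α) := by
        rw [Real.mul_rpow (by positivity) hm.le, hQ, ← sub_add_cancel p 1,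
          Real.rpow_add_one hm.ne', sub_add_cancel]
        ring
    _ ≤ Q * (Q⁻¹ * (1 - α)) * m / (1 - α) := by gcongr
    _ = m := by
        rw [mul_inv_cancel_left₀ hQ0.ne', mul_div_cancel_left₀ _ hβ.ne']

theorem exists_posBall_subset_globalData {p : ℝ} (hp : 1 < p)
    (hNp : (N : ℝ) / 2 * (p - 1) = 1) :
    ∃ C : ℝ, 0 < C ∧ ∀ᶠ α : ℝ in 𝓝[<] 1,
      posBall N (C * (1 - α) ^ ((N : ℝ) / 2)) ⊆ globalData N α p := by
  have hp0 : 0 < p := by linarith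
  have hγp : smoothingExponent N p * p = 1 := by rw [smoothingExponent_mul hp0.ne', hNp]
  have hγ : smoothingExponent N p = p⁻¹ := eq_inv_of_mul_eq_one_left hγp
  have hγ0 : 0 ≤ smoothingExponent N p := by rw [hγ]; positivity
  have hγ1 : smoothingExponent N p < 1 := by rw [hγ]; exact inv_lt_one_of_one_lt₀ hp
  obtain ⟨C₀, hP⟩ := exists_negMoment_weightP_le hγ0 hγ1
  obtain ⟨c, hc, hsmall⟩ := exists_smallness_const (p := p) hγ1 (C := max C₀ 3) (by positivity)
  refine ⟨c ^ (1 / (p - 1)), by positivity, ?_⟩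
  filter_upwards [eventually_mem_Ioo_half_one, hP, eventually_negMoment_weightS_le hγ0 hγ1.le]
    with α hα hPα hSα μ ⟨hμfin, hμ⟩
  have hβ : 0 < 1 - α := by linarith [hα.2]
  have hm : 0 < c ^ (1 / (p - 1)) * (1 - α) ^ ((N : ℝ) / 2) := by positivity
  exact ⟨hμfin, exists_isGlobalSolution hp hγp (by linarith [hα.1]) hα.2 (by positivity) hm.le
    (hPα.trans (ENNReal.ofReal_le_ofReal (le_max_left _ _)))
    (hSα.trans (ENNReal.ofReal_le_ofReal (le_max_right _ _)))
    (hsmall α hα _ hm (threshold_rpow hNp hc.le hβ.le).le) hμ⟩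

theorem exists_globalData_subset_posBall {p : ℝ} (hp : 1 < p)
    (hNp : (N : ℝ) / 2 * (p - 1) = 1) :
    ∃ C : ℝ, ∀ᶠ α : ℝ in 𝓝[<] 1,
      globalData N α p ⊆ posBall N (C * (1 - α) ^ ((N : ℝ) / 2)) := by
  have hg := gainConst_pos N
  have hk := kernelConst_pos N 4
  refine ⟨(2 / gainConst N) ^ (1 / (p - 1)) / kernelConst N 4, ?_⟩
  filter_upwards [eventually_mem_Ioo_half_one, eventually_concentratesNearOne_weightP,
    eventually_concentratesNearOne_weightS] with α hα hconcP hconcS ν ⟨hνfin, u, hu⟩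
  have hβ : 0 < 1 - α := by linarith [hα.2]
  refine ⟨hνfin, hu.measure_univ_le hα.1.le hα.2 hp hNp hconcP hconcS (by positivity) ?_⟩
  rw [div_mul_eq_mul_div, mul_div_cancel₀ _ hk.ne', threshold_rpow hNp (by positivity) hβ.le,
    ← mul_assoc, mul_div_cancel₀ _ hg.ne']

theorem posBall_mono : Monotone (posBall N) :=
  fun _ _ h _ hμ => ⟨hμ.1, hμ.2.trans (ENNReal.ofReal_le_ofReal h)⟩

theorem exists_posBall_subset_globalData_subset_posBall {p : ℝ} (hp : 1 < p)
    (hNp : (N : ℝ) / 2 * (p - 1) = 1) :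
    ∃ C₁ C₂ : ℝ, 0 < C₁ ∧ C₁ ≤ C₂ ∧ ∀ᶠ α : ℝ in 𝓝[<] 1,
      posBall N (C₁ * (1 - α) ^ ((N : ℝ) / 2)) ⊆ globalData N α p ∧
      globalData N α p ⊆ posBall N (C₂ * (1 - α) ^ ((N : ℝ) / 2)) := by
  obtain ⟨C₁, hC₁, hlower⟩ := exists_posBall_subset_globalData hp hNp
  obtain ⟨C₂, hupper⟩ := exists_globalData_subset_posBall hp hNp
  refine ⟨C₁, max C₁ C₂, hC₁, le_max_left _ _, ?_⟩
  filter_upwards [hlower, hupper, self_mem_nhdsWithin] with α hα_lower hα_upper hα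
  have : 0 ≤ 1 - α := sub_nonneg.mpr (mem_Iio.mp hα).le
  refine ⟨hα_lower, hα_upper.trans (posBall_mono ?_)⟩
  gcongr
  exact le_max_right _ _

theorem iSup_measure_univ_posBall (r : ℝ) :
    ⨆ ν ∈ posBall N r, ν univ = ENNReal.ofReal r := by
  refine le_antisymm (iSup₂_le fun ν hν => hν.2) ?_
  have hmass : (ENNReal.ofReal r • Measure.dirac (0 : Space N)) univ = ENNReal.ofReal r := by
    simp only [Measure.smul_apply, measure_univ, smul_eq_mul, mul_one]
  have hfin : IsFiniteMeasure (ENNReal.ofReal r • Measure.dirac (0 : Space N)) :=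
    ⟨hmass.trans_lt ENNReal.ofReal_lt_top⟩
  exact hmass.ge.trans (le_iSup₂ (f := fun (ν : Measure (Space N)) (_ : ν ∈ posBall N r) => ν univ)
    _ ⟨hfin, hmass.le⟩)

end Threshold

end TimeFracHeat

theorem theorem4p1 (N : ℕ) (hN : 1 ≤ N) (p : ℝ) (hp : p = TimeFracHeat.fujitaExponent N) :
    ∃ C₁ C₂ : ℝ, 0 < C₁ ∧ C₁ ≤ C₂ ∧
      (∀ᶠ α : ℝ in 𝓝[<] 1,
        TimeFracHeat.posBall N (C₁ * (1 - α) ^ ((N : ℝ) / 2)) ⊆ TimeFracHeat.globalData N α p ∧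
        TimeFracHeat.globalData N α p ⊆ TimeFracHeat.posBall N (C₂ * (1 - α) ^ ((N : ℝ) / 2))) ∧
      (∀ᶠ α : ℝ in 𝓝[<] 1,
        ENNReal.ofReal (C₁ * (1 - α) ^ ((N : ℝ) / 2)) ≤
            (⨆ ν ∈ TimeFracHeat.globalData N α p, ν univ) ∧
        (⨆ ν ∈ TimeFracHeat.globalData N α p, ν univ) ≤
            ENNReal.ofReal (C₂ * (1 - α) ^ ((N : ℝ) / 2))) ∧
      Tendsto (fun α : ℝ => ⨆ ν ∈ TimeFracHeat.globalData N α p, ν univ) (𝓝[<] 1) (𝓝 0) := by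
  have hN0 : N ≠ 0 := Nat.one_le_iff_ne_zero.mp hN
  have hN_half : (0 : ℝ) < (N : ℝ) / 2 := by positivity
  obtain ⟨C₁, C₂, hC₁, hC, hincl⟩ :=
    TimeFracHeat.exists_posBall_subset_globalData_subset_posBall
      (TimeFracHeat.one_lt_fujitaExponent hN0) (TimeFracHeat.half_mul_fujitaExponent_sub_one hN0)
  rw [← hp] at hincl
  have hsup : ∀ᶠ α : ℝ in 𝓝[<] 1,
      ENNReal.ofReal (C₁ * (1 - α) ^ ((N : ℝ) / 2)) ≤
          (⨆ ν ∈ TimeFracHeat.globalData N α p, ν univ) ∧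
      (⨆ ν ∈ TimeFracHeat.globalData N α p, ν univ) ≤
          ENNReal.ofReal (C₂ * (1 - α) ^ ((N : ℝ) / 2)) := by
    filter_upwards [hincl] with α hα
    rw [← TimeFracHeat.iSup_measure_univ_posBall (N := N),
      ← TimeFracHeat.iSup_measure_univ_posBall (N := N)]
    exact ⟨biSup_mono hα.1, biSup_mono hα.2⟩
  refine ⟨C₁, C₂, hC₁, hC, hincl, hsup, ?_⟩
  exact tendsto_of_tendsto_of_tendsto_of_le_of_le' tendsto_const_nhds
    (TimeFracHeat.tendsto_ofReal_mul_one_sub_rpow C₂ hN_half)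
    (Eventually.of_forall fun _ => zero_le) (hsup.mono fun _ h => h.2)
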